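/- **Setting.** Fix integers $d,K,T\ge 1$ and $\delta\in(0,1)$. In each round $t=1,\dots,T$ every item $k\in[K]$ has an unobserved true context $x^*_{t,k}\in\mathbb R^d$ and a real reward $r_{t,k}$. The following is assumed. There is $\theta^*\in\mathbb R^d$ with $\|\theta^*\|\le 1$ such that, given the true contexts of round $t$, the expectation of $r_{t,k}$ is $\mathbf E[r_{t,k}]=x_{t,k}^{*\top}\theta^*$. Moreover $x^*_{t,k}\sim\mathcal N(\mu_{t,k},\mathrm{diag}(\sigma_{t,k}^2))$, where $\mu_{t,k},\sigma_{t,k}\in\mathbb R^d$ are fixed and known to the learner, $\|\mu_{t,k}\|\le 1$ and $\|\sigma_{t,k}\|_\infty\le 1/\sqrt t$. The rounds (contexts and rewards of all items together) are independent; within a round the items may be dependent. Finally, the rewards are sub-Gaussian with variance proxy $1/4$, both given the contexts and on average: for all $\lambda\in\mathbb R$, $\mathbf E[e^{\lambda(r_{t,k}-x_{t,k}^{*\top}\theta^*)}\mid x^*_{t,1},\dots,x^*_{t,K}]\le e^{\lambda^2/8}$ and $\mathbf E[e^{\lambda(r_{t,k}-\mu_{t,k}^{\top}\theta^*)}]\le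 e^{\lambda^2/8}$ (as holds for every reward with values in $[0,1]$). **Algorithm SupREN** with parameter $\alpha$. For a set $\Psi$ of past rounds, with chosen items $k_\tau$ and received rewards $r_{\tau,k_\tau}$, put $A=I_d+\sum_{\tau\in\Psi}\mu_{\tau,k_\tau}\mu_{\tau,k_\tau}^\top$, $b=\sum_{\tau\in\Psi}r_{\tau,k_\tau}\mu_{\tau,k_\tau}$, $\hat r_{t,k}=\mu_{t,k}^\top A^{-1}b$ and $$w_{t,k}=(\alpha+1)\sqrt{\mu_{t,k}^\top A^{-1}\mu_{t,k}}+\Bigl(4\sqrt d+2\sqrt{\ln\tfrac{TK}{\delta}}\Bigr)\|\sigma_{t,k}\|_\infty .$$ Initially the sets $\Psi^{(s)}$, $s\ge1$, are empty. In round $t$ start with $s=1$, $\hat A_1=[K]$, and repeat until an item is chosen, computing $\hat r=\hat r^{(s)}$ and $w=w^{(s)}$ from $\Psi=\Psi^{(s)}$: (a) if $w_{t,k}\le 1/\sqrt T$ for all $k\in\hat A_s$, choose $k_t\in\arg\max_{k\in\hat A_s}(\hat r_{t,k}+w_{t,k})$ and leave all $\Psi^{(s')}$ unchanged; (b) otherwise,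 if $w_{t,k}\le 2^{-s}$ for all $k\in\hat A_s$, let $\hat A_{s+1}=\{k\in\hat A_s:\hat r_{t,k}+w_{t,k}\ge\max_{k'\in\hat A_s}(\hat r_{t,k'}+w_{t,k'})-2^{1-s}\}$ and increase $s$ by $1$; (c) otherwise choose some $k_t\in\hat A_s$ with $w_{t,k_t}>2^{-s}$ and add $t$ to $\Psi^{(s)}$. When several items are admissible in (a) or (c), the choice is made by a fixed rule depending only on $t$, $s$ and the set of admissible items. **Regret.** Let $k_t^*$ be an item that maximizes $x_{t,k}^{*\top}\theta^*$ over $k\in[K]$ (a measurable function of the contexts of round $t$), and $B(T)=\sum_{t=1}^T r_{t,k_t^*}-\sum_{t=1}^T r_{t,k_t}$. **Theorem.** If SupREN is run with $\alpha=\sqrt{\tfrac12\ln\tfrac{2TK}{\delta}}$, then with probability at least $1-\delta$ $$B(T)\le 2\sqrt T+92\Bigl(1+\ln\frac{2TK(2\ln T+2)}{\delta}\Bigr)^{3/2}\sqrt{Td}.$$ The right-hand side is $O\bigl(\sqrt{Td\,\ln^3(KT\ln(T)/\delta)}\bigr)$: there is an absolute constant $C>0$ such that for all $T\ge2$, $d,K\ge1$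 and $\delta\in(0,1)$ it is at most $C\sqrt{Td\,\ln^3(KT\ln(T)/\delta)}$. -/

import Mathlib

open MeasureTheory ProbabilityTheory

/-- Everything the learner is given before the first round: the horizon `T`, the parameters `δ`
and `α`, the means `μ t k` and the coordinatewise standard deviations `σ t k` of the contexts, and a
rule `pick t s A` that says which item of a set `A` of equally admissible items is chosen at round
`t` and level `s`. The items are the elements of `Fin K`, the rounds are `1, …, T`. -/
structure RENInput (d K : ℕ) where
  T : ℕ
  δ : ℝ
  α : ℝ
  μ : ℕ → Fin K → EuclideanSpace ℝ (Fin d)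
  σ : ℕ → Fin K → Fin d → ℝ
  pick : ℕ → ℕ → Finset (Fin K) → Fin K

namespace RENInput

variable {d K : ℕ}

/-! ### BaseREN

`Ψ` is the set of past rounds that are used, `a τ` the item chosen at round `τ`, and `y τ` the
reward that was received for it. -/

/-- `A = I + ∑_{τ ∈ Ψ} μ_{τ,a(τ)} μ_{τ,a(τ)}ᵀ`. -/
noncomputable def gram (I : RENInput d K) (Ψ : Finset ℕ) (a : ℕ → Fin K) :
    Matrix (Fin d) (Fin d) ℝ :=
  1 + ∑ τ ∈ Ψ, Matrix.vecMulVec (I.μ τ (a τ)).ofLp (I.μ τ (a τ)).ofLp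

/-- `b = ∑_{τ ∈ Ψ} y_τ μ_{τ,a(τ)}`. -/
noncomputable def response (I : RENInput d K) (Ψ : Finset ℕ) (a : ℕ → Fin K) (y : ℕ → ℝ) :
    Fin d → ℝ :=
  ∑ τ ∈ Ψ, y τ • (I.μ τ (a τ)).ofLp

/-- `s_{t,k} = √(μ_{t,k}ᵀ A⁻¹ μ_{t,k})`. -/
noncomputable def spread (I : RENInput d K) (Ψ : Finset ℕ) (a : ℕ → Fin K) (t : ℕ) (k : Fin K) :
    ℝ :=
  Real.sqrt ((I.μ t k).ofLp ⬝ᵥ Matrix.mulVec (I.gram Ψ a)⁻¹ (I.μ t k).ofLp)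

/-- The width `w_{t,k} = (α + 1) s_{t,k} + (4 √d + 2 √(ln (TK/δ))) ‖σ_{t,k}‖_∞`
(the norm of `Fin d → ℝ` is the maximum norm). -/
noncomputable def width (I : RENInput d K) (Ψ : Finset ℕ) (a : ℕ → Fin K) (t : ℕ) (k : Fin K) :
    ℝ :=
  (I.α + 1) * I.spread Ψ a t k
    + (4 * Real.sqrt d + 2 * Real.sqrt (Real.log (I.T * K / I.δ))) * ‖I.σ t k‖

/-- The estimated reward `r̂_{t,k} = μ_{t,k}ᵀ A⁻¹ b`. -/
noncomputable def estimate (I : RENInput d K) (Ψ : Finset ℕ) (a : ℕ → Fin K) (y : ℕ → ℝ)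
    (t : ℕ) (k : Fin K) : ℝ :=
  (I.μ t k).ofLp ⬝ᵥ Matrix.mulVec (I.gram Ψ a)⁻¹ (I.response Ψ a y)

/-- The upper confidence bound `r̂_{t,k} + w_{t,k}`. -/
noncomputable def ucb (I : RENInput d K) (Ψ : Finset ℕ) (a : ℕ → Fin K) (y : ℕ → ℝ)
    (t : ℕ) (k : Fin K) : ℝ :=
  I.estimate Ψ a y t k + I.width Ψ a t k

/-! ### SupREN -/

open Classical in
/-- The levels `s, s + 1, …` of round `t`, started with the candidate set `A`; `Ψ s` is the index
set of level `s`. The result is the level whose index set receives the round `t` (`none` if there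
is no such level), together with the chosen item.

The first argument bounds the number of levels visited. It never takes effect if it starts at
`n ≥ 1` with `T ≤ 4 ^ (s + n - 1)` (`selectFrom_succ` below): at a level `s'` with `T ≤ 4 ^ s'`,
that is `2 ^ (-s') ≤ 1 / √T`, the second case cannot occur, so an item is chosen there. -/
noncomputable def selectFrom (I : RENInput d K) (Ψ : ℕ → Finset ℕ) (a : ℕ → Fin K) (y : ℕ → ℝ)
    (t : ℕ) : ℕ → ℕ → Finset (Fin K) → Option ℕ × Fin K
  | 0, s, A => (none, I.pick t s A)
  | n + 1, s, A =>
    if ∀ k ∈ A, I.width (Ψ s) a t k ≤ 1 / Real.sqrt I.T then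
      (none, I.pick t s
        {k ∈ A | ∀ k' ∈ A, I.ucb (Ψ s) a y t k' ≤ I.ucb (Ψ s) a y t k})
    else if ∀ k ∈ A, I.width (Ψ s) a t k ≤ 2 ^ (-(s : ℤ)) then
      selectFrom I Ψ a y t n (s + 1)
        {k ∈ A | ∀ k' ∈ A, I.ucb (Ψ s) a y t k' - 2 ^ (1 - (s : ℤ)) ≤ I.ucb (Ψ s) a y t k}
    else
      (some s, I.pick t s {k ∈ A | 2 ^ (-(s : ℤ)) < I.width (Ψ s) a t k})

/-- The memory of SupREN: the index sets of all levels and the items chosen so far. -/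
structure Memory (K : ℕ) where
  Ψ : ℕ → Finset ℕ
  item : ℕ → Fin K

/-- What SupREN decides at round `t` from its memory, when `ρ τ k` is the reward of item `k` at
round `τ`; only the rewards `ρ τ (item τ)` of the chosen items at rounds `τ ∈ Ψ s` are read. -/
noncomputable def decision (I : RENInput d K) (ρ : ℕ → Fin K → ℝ) (t : ℕ) (m : Memory K) :
    Option ℕ × Fin K :=
  I.selectFrom m.Ψ m.item (fun τ => ρ τ (m.item τ)) t I.T 1 Finset.univ

/-- The memory after the decision of round `t`. -/
def update (t : ℕ) (m : Memory K) (c : Option ℕ × Fin K) : Memory K where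
  Ψ := match c.1 with
    | none => m.Ψ
    | some s => Function.update m.Ψ s (insert t (m.Ψ s))
  item := Function.update m.item t c.2

/-- The memory of SupREN after `t` rounds. All index sets are empty at the beginning (the initial
value of `item` is never read). -/
noncomputable def run (I : RENInput d K) (ρ : ℕ → Fin K → ℝ) : ℕ → Memory K
  | 0 => { Ψ := fun _ => ∅, item := fun _ => I.pick 0 0 Finset.univ }
  | t + 1 => update (t + 1) (I.run ρ t) (I.decision ρ (t + 1) (I.run ρ t))

/-- The item `k_t` that SupREN chooses at round `t`. -/
noncomputable def chosen (I : RENInput d K) (ρ : ℕ → Fin K → ℝ) (t : ℕ) : Fin K :=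
  (I.run ρ t).item t

/-- The regret `∑_{t ≤ T} r_{t,k*_t} - ∑_{t ≤ T} r_{t,k_t}` of SupREN, where `best t` is `k*_t`. -/
noncomputable def regret (I : RENInput d K) (ρ : ℕ → Fin K → ℝ) (best : ℕ → Fin K) : ℝ :=
  ∑ t ∈ Finset.Icc 1 I.T, ρ t (best t) - ∑ t ∈ Finset.Icc 1 I.T, ρ t (I.chosen ρ t)

/-- The bound on the number of levels never takes effect. -/
theorem selectFrom_succ (I : RENInput d K) (Ψ : ℕ → Finset ℕ) (a : ℕ → Fin K) (y : ℕ → ℝ) (t : ℕ)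
    (hT : 1 ≤ I.T) (n s : ℕ) (A : Finset (Fin K)) (hn : I.T ≤ 4 ^ (s + n)) :
    I.selectFrom Ψ a y t (n + 2) s A = I.selectFrom Ψ a y t (n + 1) s A := by
  have hpos : (0 : ℝ) < Real.sqrt I.T := Real.sqrt_pos.mpr (by exact_mod_cast hT)
  induction n generalizing s A with
  | zero =>
    have key : (2 : ℝ) ^ (-(s : ℤ)) ≤ 1 / Real.sqrt I.T := by
      rw [zpow_neg, zpow_natCast, ← one_div]
      apply one_div_le_one_div_of_le hpos
      rw [Real.sqrt_le_left (by positivity)]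
      have : (I.T : ℝ) ≤ 4 ^ s := by exact_mod_cast hn
      calc (I.T : ℝ) ≤ 4 ^ s := this
        _ = (2 ^ s) ^ 2 := by rw [← pow_mul, mul_comm, pow_mul]; norm_num
    conv_lhs => rw [selectFrom]
    conv_rhs => rw [selectFrom]
    split_ifs with h1 h2
    · rfl
    · exact absurd (fun k hk => (h2 k hk).trans key) h1
    · rfl
  | succ n ih =>
    conv_lhs => rw [selectFrom]
    conv_rhs => rw [selectFrom]
    split_ifs with h1 h2
    · rfl
    · exact ih _ _ (by rwa [show s + 1 + n = s + (n + 1) by ring])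
    · rfl

end RENInput

/-- `X` is sub-Gaussian with variance proxy `c` conditionally on the sub-σ-algebra `m`. -/
def CondSubgaussian {Ω : Type*} [MeasurableSpace Ω] (P : Measure Ω) (m : MeasurableSpace Ω)
    (X : Ω → ℝ) (c : ℝ) : Prop :=
  ∀ l : ℝ, Integrable (fun ω => Real.exp (l * X ω)) P ∧
    P[fun ω => Real.exp (l * X ω) | m] ≤ᵐ[P] fun _ => Real.exp (c * l ^ 2 / 2)

/-- The linear bandit with uncertain contexts. `x t k` is the unobserved true context of item `k`
at round `t`, `r t k` the reward of that item at that round, and `θ` the unknown parameter. -/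
structure IsUncertainLinearBandit {Ω : Type*} [MeasurableSpace Ω] (P : Measure Ω) {d K : ℕ}
    (I : RENInput d K) (θ : EuclideanSpace ℝ (Fin d))
    (x : ℕ → Fin K → Ω → EuclideanSpace ℝ (Fin d)) (r : ℕ → Fin K → Ω → ℝ) : Prop where
  measurable_context : ∀ t ∈ Finset.Icc 1 I.T, ∀ k, Measurable (x t k)
  measurable_reward : ∀ t ∈ Finset.Icc 1 I.T, ∀ k, Measurable (r t k)
  /-- Different rounds are independent (the items within one round need not be). -/
  indep_rounds : iIndepFun
    (fun (t : Finset.Icc 1 I.T) (ω : Ω) => (fun k => x t k ω, fun k => r t k ω)) P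
  /-- `‖θ*‖ ≤ 1`. -/
  norm_param_le : ‖θ‖ ≤ 1
  /-- `‖μ_{t,k}‖ ≤ 1`. -/
  norm_mean_le : ∀ t ∈ Finset.Icc 1 I.T, ∀ k, ‖I.μ t k‖ ≤ 1
  /-- `x*_{t,k} ∼ N(μ_{t,k}, diag(σ_{t,k}²))`. -/
  law_context : ∀ t ∈ Finset.Icc 1 I.T, ∀ k,
    P.map (x t k) = multivariateGaussian (I.μ t k) (Matrix.diagonal fun i => I.σ t k i ^ 2)
  /-- `‖σ_{t,k}‖_∞ ≤ 1/√t`. -/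
  norm_sd_le : ∀ t ∈ Finset.Icc 1 I.T, ∀ k, ‖I.σ t k‖ ≤ 1 / Real.sqrt t
  /-- `E[r_{t,k}] = ⟨x*_{t,k}, θ*⟩`, given the true contexts of round `t`. -/
  mean_reward : ∀ t ∈ Finset.Icc 1 I.T, ∀ k,
    Integrable (r t k) P ∧
    P[r t k | MeasurableSpace.comap (fun ω k' => x t k' ω) inferInstance]
      =ᵐ[P] fun ω => inner ℝ (x t k ω) θ
  /-- Given the true contexts of round `t`, the reward is sub-Gaussian about its conditional mean
  with variance proxy `1/4`, as is every random variable with values in an interval of length 1. -/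
  reward_cond_subgaussian : ∀ t ∈ Finset.Icc 1 I.T, ∀ k,
    CondSubgaussian P (MeasurableSpace.comap (fun ω k' => x t k' ω) inferInstance)
      (fun ω => r t k ω - inner ℝ (x t k ω) θ) (1 / 4)
  /-- The reward is sub-Gaussian about its mean `⟨μ_{t,k}, θ*⟩` with variance proxy `1/4`, as is
  every random variable with values in an interval of length 1. -/
  reward_subgaussian : ∀ t ∈ Finset.Icc 1 I.T, ∀ k,
    HasSubgaussianMGF (fun ω => r t k ω - inner ℝ (I.μ t k) θ) (1 / 4) P

/-- `2√T + 92 (1 + ln(2TK(2 ln T + 2)/δ))^{3/2} √(Td)`. -/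
noncomputable def regretBound (d K T : ℕ) (δ : ℝ) : ℝ :=
  2 * Real.sqrt T
    + 92 * (1 + Real.log (2 * T * K * (2 * Real.log T + 2) / δ)) ^ (3 / 2 : ℝ) * Real.sqrt (T * d)

namespace RENInput

variable {d K : ℕ}

/-! ### The regularized Gram matrix -/

/-! Let `k₀ t` be an item with the largest ⟨μ_{t,k}, θ⟩. The regret is the sum of four parts: the
noise r − ⟨x*, θ⟩ of the best items, the excess of ⟨x*, θ⟩ at the best item over the mean of `k₀ t`,
the gap between the means of `k₀ t` and of the chosen item, and the noise ⟨μ, θ⟩ − r of the chosen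
items.

The best item is a function of the contexts of its round and the chosen item is a function of
earlier rewards, so both noise sums are sub-Gaussian with proxy T/4 (`hasSubgaussianMGF_sum_best`,
`hasSubgaussianMGF_sum_chosen`). The excess is at most the Gaussian deviation of one item, of order
√(L/t) with L = `regretLog`, which sums to √(TL).

The third part is a linear bandit with the known contexts μ. A round put into level s has gap at
most 8·2^(-s) (`selectFrom_gap`) and a width above 2^(-s). The elliptical potential bounds the sum
of the widths over a level, hence the size of the level (`card_index_le`); Cauchy–Schwarz over the
disjoint levels finishes the count.

The confidence bounds rest on the layering: the index set of a level and the items chosen on it are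
determined by rewards outside that level (`history_congr`), so given this history the rewards on the
level are still independent and Hoeffding's inequality applies (`measure_confidenceFails_le`). The
given α is too small for a union bound over levels. Instead, the expected number of rounds with a
failing bound is at most δ times the number of levels; by Markov fewer than 4 · `levels` rounds fail
outside probability δ/4, and each costs at most 2. The four exceptional events have probability at
most δ/4 each. -/

theorem gram_congr (I : RENInput d K) {Ψ : Finset ℕ} {a a' : ℕ → Fin K}
    (h : ∀ τ ∈ Ψ, a τ = a' τ) : I.gram Ψ a = I.gram Ψ a' := by
  unfold gram
  congr 1
  exact Finset.sum_congr rfl fun τ hτ => by rw [h τ hτ]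

theorem spread_congr (I : RENInput d K) {Ψ : Finset ℕ} {a a' : ℕ → Fin K}
    (h : ∀ τ ∈ Ψ, a τ = a' τ) (t : ℕ) (k : Fin K) : I.spread Ψ a t k = I.spread Ψ a' t k := by
  rw [spread, spread, I.gram_congr h]

theorem width_congr (I : RENInput d K) {Ψ : Finset ℕ} {a a' : ℕ → Fin K}
    (h : ∀ τ ∈ Ψ, a τ = a' τ) (t : ℕ) (k : Fin K) : I.width Ψ a t k = I.width Ψ a' t k := by
  rw [width, width, I.spread_congr h]

theorem estimate_congr (I : RENInput d K) {Ψ : Finset ℕ} {a a' : ℕ → Fin K} {y y' : ℕ → ℝ}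
    (h : ∀ τ ∈ Ψ, a τ = a' τ) (hy : ∀ τ ∈ Ψ, y τ = y' τ) (t : ℕ) (k : Fin K) :
    I.estimate Ψ a y t k = I.estimate Ψ a' y' t k := by
  have : I.response Ψ a y = I.response Ψ a' y' :=
    Finset.sum_congr rfl fun τ hτ => by rw [h τ hτ, hy τ hτ]
  rw [estimate, estimate, I.gram_congr h, this]

theorem ucb_congr (I : RENInput d K) {Ψ : Finset ℕ} {a a' : ℕ → Fin K} {y y' : ℕ → ℝ}
    (h : ∀ τ ∈ Ψ, a τ = a' τ) (hy : ∀ τ ∈ Ψ, y τ = y' τ) (t : ℕ) (k : Fin K) :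
    I.ucb Ψ a y t k = I.ucb Ψ a' y' t k := by
  rw [ucb, ucb, I.estimate_congr h hy, I.width_congr h]

theorem gram_mulVec (I : RENInput d K) (Ψ : Finset ℕ) (a : ℕ → Fin K) (w : Fin d → ℝ) :
    Matrix.mulVec (I.gram Ψ a) w
      = w + ∑ τ ∈ Ψ, ((I.μ τ (a τ)).ofLp ⬝ᵥ w) • (I.μ τ (a τ)).ofLp := by
  rw [gram, Matrix.add_mulVec, Matrix.one_mulVec, Matrix.sum_mulVec]
  congr 1
  refine Finset.sum_congr rfl fun τ _ => ?_
  rw [Matrix.vecMulVec_mulVec]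
  ext i
  simp [mul_comm]

theorem dotProduct_gram_mulVec (I : RENInput d K) (Ψ : Finset ℕ) (a : ℕ → Fin K)
    (z w : Fin d → ℝ) :
    z ⬝ᵥ Matrix.mulVec (I.gram Ψ a) w
      = z ⬝ᵥ w + ∑ τ ∈ Ψ, (z ⬝ᵥ (I.μ τ (a τ)).ofLp) * ((I.μ τ (a τ)).ofLp ⬝ᵥ w) := by
  rw [gram_mulVec, dotProduct_add, dotProduct_sum]
  congr 1
  refine Finset.sum_congr rfl fun τ _ => ?_
  rw [dotProduct_smul, smul_eq_mul, mul_comm]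

theorem gram_isHermitian (I : RENInput d K) (Ψ : Finset ℕ) (a : ℕ → Fin K) :
    (I.gram Ψ a).IsHermitian := by
  unfold gram
  rw [Matrix.IsHermitian, Matrix.conjTranspose_add, Matrix.conjTranspose_one,
    Matrix.conjTranspose_sum]
  congr 1
  refine Finset.sum_congr rfl fun τ _ => ?_
  ext i j
  simp [Matrix.vecMulVec_apply, mul_comm]

theorem gram_posDef (I : RENInput d K) (Ψ : Finset ℕ) (a : ℕ → Fin K) :
    (I.gram Ψ a).PosDef := by
  refine Matrix.PosDef.of_dotProduct_mulVec_pos (I.gram_isHermitian Ψ a) fun x hx => ?_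
  rw [star_trivial, dotProduct_gram_mulVec]
  have h1 : 0 < x ⬝ᵥ x := by
    simpa using (Matrix.dotProduct_star_self_pos_iff (v := x)).2 hx
  have h2 : 0 ≤ ∑ τ ∈ Ψ, (x ⬝ᵥ (I.μ τ (a τ)).ofLp) * ((I.μ τ (a τ)).ofLp ⬝ᵥ x) :=
    Finset.sum_nonneg fun τ _ => by
      rw [dotProduct_comm _ x]; exact mul_self_nonneg _
  linarith

theorem gram_det_pos (I : RENInput d K) (Ψ : Finset ℕ) (a : ℕ → Fin K) :
    0 < (I.gram Ψ a).det := (I.gram_posDef Ψ a).det_pos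

/-- The vector `A⁻¹ μ_{t,k}`. -/
noncomputable def dual (I : RENInput d K) (Ψ : Finset ℕ) (a : ℕ → Fin K) (t : ℕ) (k : Fin K) :
    Fin d → ℝ :=
  Matrix.mulVec (I.gram Ψ a)⁻¹ (I.μ t k).ofLp

theorem gram_mulVec_dual (I : RENInput d K) (Ψ : Finset ℕ) (a : ℕ → Fin K) (t : ℕ) (k : Fin K) :
    Matrix.mulVec (I.gram Ψ a) (I.dual Ψ a t k) = (I.μ t k).ofLp := by
  rw [dual, Matrix.mulVec_mulVec, Matrix.mul_nonsing_inv _ (I.gram_det_pos Ψ a).ne'.isUnit,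
    Matrix.one_mulVec]

theorem dotProduct_gram_inv (I : RENInput d K) (Ψ : Finset ℕ) (a : ℕ → Fin K) (t : ℕ) (k : Fin K)
    (b : Fin d → ℝ) :
    (I.μ t k).ofLp ⬝ᵥ Matrix.mulVec (I.gram Ψ a)⁻¹ b = I.dual Ψ a t k ⬝ᵥ b := by
  have h : (I.gram Ψ a)⁻¹.transpose = (I.gram Ψ a)⁻¹ := by
    have := (I.gram_isHermitian Ψ a).inv
    rwa [Matrix.IsHermitian, Matrix.conjTranspose_eq_transpose_of_trivial] at this
  rw [Matrix.dotProduct_mulVec, dual, ← Matrix.mulVec_transpose, h]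

/-- With v = A⁻¹μ the left side is vᵀAv. The first summand of the result controls the bias of the
estimate, the second its variance. -/
theorem quadForm_eq (I : RENInput d K) (Ψ : Finset ℕ) (a : ℕ → Fin K) (t : ℕ) (k : Fin K) :
    (I.μ t k).ofLp ⬝ᵥ Matrix.mulVec (I.gram Ψ a)⁻¹ (I.μ t k).ofLp
      = I.dual Ψ a t k ⬝ᵥ I.dual Ψ a t k
        + ∑ τ ∈ Ψ, (I.dual Ψ a t k ⬝ᵥ (I.μ τ (a τ)).ofLp) ^ 2 := by
  rw [dotProduct_gram_inv, ← I.gram_mulVec_dual Ψ a t k, dotProduct_gram_mulVec]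
  congr 1
  refine Finset.sum_congr rfl fun τ _ => ?_
  rw [dotProduct_comm (I.μ τ (a τ)).ofLp, sq]

theorem quadForm_nonneg (I : RENInput d K) (Ψ : Finset ℕ) (a : ℕ → Fin K) (t : ℕ) (k : Fin K) :
    0 ≤ (I.μ t k).ofLp ⬝ᵥ Matrix.mulVec (I.gram Ψ a)⁻¹ (I.μ t k).ofLp := by
  rw [quadForm_eq]
  exact add_nonneg (Finset.sum_nonneg fun _ _ => mul_self_nonneg _) (Finset.sum_nonneg fun _ _ => sq_nonneg _)

theorem sq_spread (I : RENInput d K) (Ψ : Finset ℕ) (a : ℕ → Fin K) (t : ℕ) (k : Fin K) :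
    I.spread Ψ a t k ^ 2 = I.dual Ψ a t k ⬝ᵥ I.dual Ψ a t k
        + ∑ τ ∈ Ψ, (I.dual Ψ a t k ⬝ᵥ (I.μ τ (a τ)).ofLp) ^ 2 := by
  rw [spread, Real.sq_sqrt (I.quadForm_nonneg Ψ a t k), quadForm_eq]

theorem spread_nonneg (I : RENInput d K) (Ψ : Finset ℕ) (a : ℕ → Fin K) (t : ℕ) (k : Fin K) :
    0 ≤ I.spread Ψ a t k := Real.sqrt_nonneg _

theorem dotProduct_self_eq_norm_sq (x : EuclideanSpace ℝ (Fin d)) :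
    x.ofLp ⬝ᵥ x.ofLp = ‖x‖ ^ 2 := by
  rw [EuclideanSpace.norm_sq_eq]
  simp [dotProduct, sq]

theorem abs_dotProduct_le (x y : EuclideanSpace ℝ (Fin d)) : |x.ofLp ⬝ᵥ y.ofLp| ≤ ‖x‖ * ‖y‖ := by
  have := abs_real_inner_le_norm y x
  rwa [EuclideanSpace.inner_eq_star_dotProduct, star_trivial, mul_comm] at this

theorem inner_eq_dotProduct (x y : EuclideanSpace ℝ (Fin d)) :
    inner ℝ x y = x.ofLp ⬝ᵥ y.ofLp := by
  rw [EuclideanSpace.inner_eq_star_dotProduct, star_trivial, dotProduct_comm]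

theorem norm_dual_le (I : RENInput d K) (Ψ : Finset ℕ) (a : ℕ → Fin K) (t : ℕ) (k : Fin K) :
    ‖(WithLp.toLp 2 (I.dual Ψ a t k) : EuclideanSpace ℝ (Fin d))‖ ≤ I.spread Ψ a t k := by
  refine (sq_le_sq₀ (norm_nonneg _) (I.spread_nonneg Ψ a t k)).1 ?_
  rw [← dotProduct_self_eq_norm_sq, sq_spread]
  exact le_add_of_nonneg_right (Finset.sum_nonneg fun _ _ => sq_nonneg _)

/-- Writing s for the spread and v = A⁻¹μ, Cauchy–Schwarz gives s² = μ·v ≤ ‖μ‖‖v‖ ≤ s. -/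
theorem spread_le_one (I : RENInput d K) (Ψ : Finset ℕ) (a : ℕ → Fin K) (t : ℕ) (k : Fin K)
    (h : ‖I.μ t k‖ ≤ 1) : I.spread Ψ a t k ≤ 1 := by
  have h1 : I.spread Ψ a t k ^ 2 ≤ I.spread Ψ a t k := by
    rw [spread, Real.sq_sqrt (I.quadForm_nonneg Ψ a t k), ← spread]
    refine (le_abs_self _).trans ((abs_dotProduct_le (I.μ t k)
      (WithLp.toLp 2 (I.dual Ψ a t k))).trans ?_)
    calc _ ≤ 1 * I.spread Ψ a t k :=
          mul_le_mul h (I.norm_dual_le Ψ a t k) (norm_nonneg _) zero_le_one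
      _ = _ := one_mul _
  nlinarith [I.spread_nonneg Ψ a t k]

/-- The error of the estimate consists of the noise and of a bias of at most one spread. -/
theorem abs_estimate_sub_le (I : RENInput d K) (Ψ : Finset ℕ) (a : ℕ → Fin K) (y : ℕ → ℝ)
    (t : ℕ) (k : Fin K) (θ : EuclideanSpace ℝ (Fin d)) (hθ : ‖θ‖ ≤ 1) :
    |I.estimate Ψ a y t k - inner ℝ (I.μ t k) θ|
      ≤ |∑ τ ∈ Ψ, (I.dual Ψ a t k ⬝ᵥ (I.μ τ (a τ)).ofLp) * (y τ - inner ℝ (I.μ τ (a τ)) θ)|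
        + I.spread Ψ a t k := by
  -- Substituting μ = Av expands the mean in the same weights as the estimate; the identity part of
  -- A leaves the term v·θ, which is the bias of the regularization.
  have h1 : inner ℝ (I.μ t k) θ = I.dual Ψ a t k ⬝ᵥ θ.ofLp
      + ∑ τ ∈ Ψ, (I.dual Ψ a t k ⬝ᵥ (I.μ τ (a τ)).ofLp) * inner ℝ (I.μ τ (a τ)) θ := by
    simp_rw [inner_eq_dotProduct]
    conv_lhs => rw [← I.gram_mulVec_dual Ψ a t k]
    rw [dotProduct_comm, dotProduct_gram_mulVec, dotProduct_comm θ.ofLp]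
    congr 1
    refine Finset.sum_congr rfl fun τ _ => ?_
    rw [dotProduct_comm θ.ofLp, dotProduct_comm _ (I.dual Ψ a t k), mul_comm]
  have h2 : I.estimate Ψ a y t k
      = ∑ τ ∈ Ψ, (I.dual Ψ a t k ⬝ᵥ (I.μ τ (a τ)).ofLp) * y τ := by
    rw [estimate, dotProduct_gram_inv, response, dotProduct_sum]
    refine Finset.sum_congr rfl fun τ _ => ?_
    rw [dotProduct_smul, smul_eq_mul, mul_comm]
  have h3 : |I.dual Ψ a t k ⬝ᵥ θ.ofLp| ≤ I.spread Ψ a t k := by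
    refine (abs_dotProduct_le (WithLp.toLp 2 (I.dual Ψ a t k)) θ).trans ?_
    calc _ ≤ I.spread Ψ a t k * 1 :=
          mul_le_mul (I.norm_dual_le Ψ a t k) hθ (norm_nonneg _) (I.spread_nonneg Ψ a t k)
      _ = _ := mul_one _
  rw [h1, h2]
  simp_rw [mul_sub, Finset.sum_sub_distrib]
  rw [abs_le] at h3
  rw [abs_le]
  have h4 := neg_abs_le (∑ τ ∈ Ψ, (I.dual Ψ a t k ⬝ᵥ (I.μ τ (a τ)).ofLp) * y τ
    - ∑ τ ∈ Ψ, (I.dual Ψ a t k ⬝ᵥ (I.μ τ (a τ)).ofLp) * inner ℝ (I.μ τ (a τ)) θ)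
  have h5 := le_abs_self (∑ τ ∈ Ψ, (I.dual Ψ a t k ⬝ᵥ (I.μ τ (a τ)).ofLp) * y τ
    - ∑ τ ∈ Ψ, (I.dual Ψ a t k ⬝ᵥ (I.μ τ (a τ)).ofLp) * inner ℝ (I.μ τ (a τ)) θ)
  constructor <;> linarith [h3.1, h3.2]

/-! ### The elliptical potential -/

/-- Matrix determinant lemma for a rank-one update; log det is the potential that grows with each
round. -/
theorem det_gram_insert (I : RENInput d K) (Ψ : Finset ℕ) (a : ℕ → Fin K) (t : ℕ) (ht : t ∉ Ψ) :
    (I.gram (insert t Ψ) a).det = (I.gram Ψ a).det * (1 + I.spread Ψ a t (a t) ^ 2) := by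
  have h : I.gram (insert t Ψ) a
      = I.gram Ψ a + Matrix.replicateCol Unit (I.μ t (a t)).ofLp
          * Matrix.replicateRow Unit (I.μ t (a t)).ofLp := by
    rw [gram, Finset.sum_insert ht, gram, Matrix.vecMulVec_eq Unit]
    abel
  rw [h, Matrix.det_add_replicateCol_mul_replicateRow (I.gram_det_pos Ψ a).ne'.isUnit, spread,
    Real.sq_sqrt (I.quadForm_nonneg Ψ a t (a t))]
  congr 1
  rw [Matrix.det_unique, Matrix.add_apply, Matrix.one_apply_eq]
  congr 1
  rw [Matrix.dotProduct_mulVec, ← Matrix.replicateRow_vecMul]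
  rfl

theorem le_two_mul_log_one_add {x : ℝ} (h0 : 0 ≤ x) (h1 : x ≤ 1) : x ≤ 2 * Real.log (1 + x) := by
  have h := Real.one_sub_inv_le_log_of_pos (show 0 < 1 + x by linarith)
  have : x / 2 ≤ 1 - (1 + x)⁻¹ := by
    rw [← sub_nonneg]
    have : 1 - (1 + x)⁻¹ - x / 2 = x * (1 - x) / (2 * (1 + x)) := by field_simp; ring
    rw [this]
    exact div_nonneg (mul_nonneg h0 (by linarith)) (by linarith)
  linarith

/-- Adding the rounds in increasing order telescopes log det, and s² ≤ 2 log(1 + s²) because s ≤ 1.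
The latest round sees all the others as its past, and the pasts of the others do not change. -/
theorem sum_sq_spread_le_log_det (I : RENInput d K) (Ψ : Finset ℕ) (a : ℕ → Fin K)
    (h : ∀ t ∈ Ψ, ‖I.μ t (a t)‖ ≤ 1) :
    ∑ t ∈ Ψ, I.spread {τ ∈ Ψ | τ < t} a t (a t) ^ 2 ≤ 2 * Real.log (I.gram Ψ a).det := by
  induction Ψ using Finset.induction_on_max with
  | empty => simp [gram]
  | insert t Ψ hlt ih =>
    have ht : t ∉ Ψ := fun hmem => lt_irrefl _ (hlt t hmem)
    have e1 : {τ ∈ insert t Ψ | τ < t} = Ψ := by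
      ext τ
      simp only [Finset.mem_filter, Finset.mem_insert]
      constructor
      · rintro ⟨rfl | h, h'⟩
        · exact absurd h' (lt_irrefl _)
        · exact h
      · exact fun h => ⟨Or.inr h, hlt τ h⟩
    have e2 : ∀ u ∈ Ψ, {τ ∈ insert t Ψ | τ < u} = {τ ∈ Ψ | τ < u} := by
      intro u hu
      rw [Finset.filter_insert, if_neg (not_lt.2 (hlt u hu).le)]
    rw [Finset.sum_insert ht, e1, det_gram_insert I Ψ a t ht,
      Finset.sum_congr rfl fun u hu => by rw [e2 u hu],
      Real.log_mul (I.gram_det_pos Ψ a).ne' (by positivity), mul_add, add_comm]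
    refine add_le_add (ih fun u hu => h u (Finset.mem_insert_of_mem hu)) ?_
    refine le_two_mul_log_one_add (sq_nonneg _) ?_
    exact pow_le_one₀ (I.spread_nonneg _ _ _ _)
      (I.spread_le_one _ _ _ _ (h t (Finset.mem_insert_self t Ψ)))

/-- Each eigenvalue is the quadratic form at a unit eigenvector, hence at most one plus the number
of unit-bounded rank-one terms. -/
theorem det_gram_le (I : RENInput d K) (Ψ : Finset ℕ) (a : ℕ → Fin K)
    (h : ∀ t ∈ Ψ, ‖I.μ t (a t)‖ ≤ 1) : (I.gram Ψ a).det ≤ (1 + Ψ.card : ℝ) ^ d := by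
  have hH := I.gram_isHermitian Ψ a
  rw [hH.det_eq_prod_eigenvalues]
  have hb : ∀ i ∈ Finset.univ, (hH.eigenvalues i : ℝ) ≤ 1 + Ψ.card := by
    intro i _
    have hn : ‖hH.eigenvectorBasis i‖ = 1 := hH.eigenvectorBasis.orthonormal.1 i
    have e1 : (hH.eigenvectorBasis i).ofLp ⬝ᵥ (hH.eigenvectorBasis i).ofLp = 1 := by
      rw [dotProduct_self_eq_norm_sq, hn, one_pow]
    have e := I.dotProduct_gram_mulVec Ψ a (hH.eigenvectorBasis i).ofLp
      (hH.eigenvectorBasis i).ofLp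
    rw [hH.mulVec_eigenvectorBasis, dotProduct_smul, e1, smul_eq_mul, mul_one] at e
    rw [e]
    have : ∑ τ ∈ Ψ, ((hH.eigenvectorBasis i).ofLp ⬝ᵥ (I.μ τ (a τ)).ofLp)
        * ((I.μ τ (a τ)).ofLp ⬝ᵥ (hH.eigenvectorBasis i).ofLp) ≤ ∑ τ ∈ Ψ, (1 : ℝ) := by
      refine Finset.sum_le_sum fun τ hτ => ?_
      rw [dotProduct_comm _ (hH.eigenvectorBasis i).ofLp, ← sq, sq_le_one_iff_abs_le_one]
      refine (abs_dotProduct_le _ _).trans ?_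
      rw [hn, one_mul]
      exact h τ hτ
    simpa using this
  calc _ ≤ ∏ _i : Fin d, (1 + Ψ.card : ℝ) :=
        Finset.prod_le_prod (fun i _ => ((I.gram_posDef Ψ a).eigenvalues_pos i).le) hb
    _ = _ := by simp

theorem sum_spread_le (I : RENInput d K) (Ψ : Finset ℕ) (a : ℕ → Fin K)
    (h : ∀ t ∈ Ψ, ‖I.μ t (a t)‖ ≤ 1) :
    ∑ t ∈ Ψ, I.spread {τ ∈ Ψ | τ < t} a t (a t)
      ≤ Real.sqrt Ψ.card * Real.sqrt (2 * d * Real.log (1 + Ψ.card)) := by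
  have h1 := sum_sq_spread_le_log_det I Ψ a h
  have h2 : Real.log (I.gram Ψ a).det ≤ d * Real.log (1 + Ψ.card) := by
    rw [← Real.log_pow]
    exact Real.log_le_log (I.gram_det_pos Ψ a) (I.det_gram_le Ψ a h)
  rw [← Real.sqrt_mul (by positivity)]
  refine Real.le_sqrt_of_sq_le (sq_sum_le_card_mul_sum_sq.trans ?_)
  exact mul_le_mul_of_nonneg_left (by linarith) (by positivity)

end RENInput

namespace RENInput

variable {d K : ℕ}

/-! ### The course of one round -/

theorem selectFrom_level_ge (I : RENInput d K) (Ψ : ℕ → Finset ℕ) (a : ℕ → Fin K) (y : ℕ → ℝ)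
    (t n s : ℕ) (A : Finset (Fin K)) (s' : ℕ) (h : (I.selectFrom Ψ a y t n s A).1 = some s') :
    s ≤ s' := by
  induction n generalizing s A with
  | zero => simp [selectFrom] at h
  | succ n ih =>
    rw [selectFrom] at h
    split_ifs at h with h1 h2
    · exact (Nat.le_succ s).trans (ih _ _ h)
    · simp at h; exact h.le

/-- Two runs that agree on the levels up to `s`, except possibly for the rewards on level `s`,
decide in the same way, unless both of them leave the levels up to `s` unchanged. -/
theorem selectFrom_eq_or (I : RENInput d K) {Ψ Ψ' : ℕ → Finset ℕ} {a a' : ℕ → Fin K}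
    {y y' : ℕ → ℝ} (t n s s₀ : ℕ) (A : Finset (Fin K)) (hs : s₀ ≤ s)
    (hΨ : ∀ s' ≤ s, Ψ s' = Ψ' s') (ha : ∀ s' ≤ s, ∀ τ ∈ Ψ s', a τ = a' τ)
    (hy : ∀ s' < s, ∀ τ ∈ Ψ s', y τ = y' τ) :
    I.selectFrom Ψ a y t n s₀ A = I.selectFrom Ψ' a' y' t n s₀ A ∨
      (∀ s' ≤ s, (I.selectFrom Ψ a y t n s₀ A).1 ≠ some s') ∧
      (∀ s' ≤ s, (I.selectFrom Ψ' a' y' t n s₀ A).1 ≠ some s') := by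
  induction n generalizing s₀ A with
  | zero => left; rfl
  | succ n ih =>
    -- Widths do not involve rewards, so even on level s both runs enter the same case. Only cases
    -- (a) and (b) read the rewards of level s, and both leave the levels up to s unchanged.
    have hw : ∀ k, I.width (Ψ' s₀) a' t k = I.width (Ψ s₀) a t k := fun k => by
      rw [← hΨ s₀ hs, I.width_congr (ha s₀ hs)]
    rw [selectFrom, selectFrom]
    simp only [hw]
    split_ifs with h1 h2
    · right
      simp
    · rcases hs.lt_or_eq with hlt | rfl
      · have hu : ∀ k, I.ucb (Ψ' s₀) a' y' t k = I.ucb (Ψ s₀) a y t k := fun k => by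
          rw [← hΨ s₀ hs, I.ucb_congr (ha s₀ hs) (hy s₀ hlt)]
        simp only [hu]
        exact ih (s₀ + 1) _ hlt
      · right
        constructor <;> intro s' hs' h <;> have := I.selectFrom_level_ge _ _ _ _ _ _ _ _ h <;> omega
    · left; rfl

theorem selectFrom_congr (I : RENInput d K) (Ψ : ℕ → Finset ℕ) (a : ℕ → Fin K)
    {y y' : ℕ → ℝ} (t n s : ℕ) (A : Finset (Fin K)) (hy : ∀ s, ∀ τ ∈ Ψ s, y τ = y' τ) :
    I.selectFrom Ψ a y t n s A = I.selectFrom Ψ a y' t n s A := by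
  induction n generalizing s A with
  | zero => rfl
  | succ n ih =>
    have hu : ∀ k, I.ucb (Ψ s) a y' t k = I.ucb (Ψ s) a y t k := fun k =>
      (I.ucb_congr (fun _ _ => rfl) (hy s) t k).symm
    rw [selectFrom, selectFrom]
    simp only [hu, ih]

/-- Passing level s requires some width above 1/√T and all widths at most 2^(-s). This limits the
levels reached to about log₄ T. -/
theorem four_pow_lt {T s : ℕ} (hT : 1 ≤ T) (h : 1 / Real.sqrt T < (2 : ℝ) ^ (-(s : ℤ))) :
    4 ^ s < T := by
  have hT' : (0 : ℝ) < Real.sqrt T := Real.sqrt_pos.2 (by exact_mod_cast hT)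
  rw [zpow_neg, zpow_natCast, ← one_div, one_div_lt_one_div hT' (by positivity),
    Real.lt_sqrt (by positivity), ← pow_mul, mul_comm, pow_mul] at h
  norm_num at h
  exact_mod_cast h

/-- A round that is added to level `s` is added because the chosen item has a large width there. -/
theorem selectFrom_some (I : RENInput d K) (Ψ : ℕ → Finset ℕ) (a : ℕ → Fin K) (y : ℕ → ℝ)
    (hpick : ∀ t s A, A.Nonempty → I.pick t s A ∈ A) (hT : 1 ≤ I.T)
    (t n s : ℕ) (A : Finset (Fin K)) (hs : s = 1 ∨ 4 ^ (s - 1) < I.T) (s' : ℕ)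
    (h : (I.selectFrom Ψ a y t n s A).1 = some s') :
    (s' = 1 ∨ 4 ^ (s' - 1) < I.T) ∧
      (2 : ℝ) ^ (-(s' : ℤ)) < I.width (Ψ s') a t (I.selectFrom Ψ a y t n s A).2 := by
  induction n generalizing s A with
  | zero => simp [selectFrom] at h
  | succ n ih =>
    rw [selectFrom] at h ⊢
    split_ifs at h ⊢ with h1 h2
    · refine ih _ _ (Or.inr ?_) h
      obtain ⟨k, hk, hlt⟩ := by simpa only [not_forall, not_le] using h1
      exact four_pow_lt hT (hlt.trans_le (h2 k hk))
    · simp only [Option.some.injEq] at h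
      subst h
      refine ⟨hs, ?_⟩
      have hne : ({k ∈ A | (2 : ℝ) ^ (-(s : ℤ)) < I.width (Ψ s) a t k} : Finset _).Nonempty := by
        obtain ⟨k, hk, hlt⟩ := by simpa only [not_forall, not_le] using h2
        exact ⟨k, Finset.mem_filter.2 ⟨hk, hlt⟩⟩
      exact (Finset.mem_filter.1 (hpick t s _ hne)).2

theorem spread_le_width (I : RENInput d K) (Ψ : Finset ℕ) (a : ℕ → Fin K) (t : ℕ) (k : Fin K) :
    (I.α + 1) * I.spread Ψ a t k ≤ I.width Ψ a t k := by
  rw [width]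
  exact le_add_of_nonneg_right (by positivity)

/-- At a round where the confidence bounds hold on all levels, the item chosen is nearly as good as
the best item `k₀`, up to the accuracy of the level at which the choice is made. -/
theorem selectFrom_gap (I : RENInput d K) (Ψ : ℕ → Finset ℕ) (a : ℕ → Fin K) (y : ℕ → ℝ)
    (hpick : ∀ t s A, A.Nonempty → I.pick t s A ∈ A) (hT : 1 ≤ I.T) (v : Fin K → ℝ) (k₀ : Fin K)
    (hk₀ : ∀ k, v k ≤ v k₀) (t n s : ℕ) (A : Finset (Fin K)) (hs : s = 1 ∨ 4 ^ (s - 1) < I.T)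
    (hn : s + n = I.T + 1)
    (hs1 : 1 ≤ s) (hconf : ∀ s, 1 ≤ s → (s = 1 ∨ 4 ^ (s - 1) < I.T) → ∀ k,
      |I.estimate (Ψ s) a y t k - v k| ≤ I.width (Ψ s) a t k)
    (hmem : k₀ ∈ A) (hgap : ∀ k ∈ A, v k₀ - v k ≤ 8 * (2 : ℝ) ^ (-(s : ℤ))) :
    ((I.selectFrom Ψ a y t n s A).1 = none →
      v k₀ - v (I.selectFrom Ψ a y t n s A).2 ≤ 2 * (1 / Real.sqrt I.T)) ∧
    ∀ s', (I.selectFrom Ψ a y t n s A).1 = some s' →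
      v k₀ - v (I.selectFrom Ψ a y t n s A).2 ≤ 8 * (2 : ℝ) ^ (-(s' : ℤ)) := by
  induction n generalizing s A with
  | zero =>
    -- Running out of levels would mean standing at level T + 1, which is reached only if 4^T < T.
    exfalso
    have h1 : I.T < 4 ^ I.T := Nat.lt_pow_self (by norm_num)
    obtain rfl : s = I.T + 1 := by omega
    rcases hs with h | h
    · omega
    · rw [Nat.add_sub_cancel] at h
      omega
  | succ n ih =>
    have hc := hconf s hs1 hs
    have hupper : ∀ k, v k ≤ I.ucb (Ψ s) a y t k := fun k => by
      have := (abs_le.1 (hc k)).1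
      rw [ucb]; linarith
    have hlower : ∀ k, I.ucb (Ψ s) a y t k ≤ v k + 2 * I.width (Ψ s) a t k := fun k => by
      have := (abs_le.1 (hc k)).2
      rw [ucb]; linarith
    rw [selectFrom]
    split_ifs with h1 h2
    · refine ⟨fun _ => ?_, fun s' h => by simp at h⟩
      have hne : ({k ∈ A | ∀ k' ∈ A, I.ucb (Ψ s) a y t k' ≤ I.ucb (Ψ s) a y t k}
          : Finset _).Nonempty := by
        obtain ⟨k, hk, hmax⟩ := A.exists_max_image (fun k => I.ucb (Ψ s) a y t k) ⟨k₀, hmem⟩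
        exact ⟨k, Finset.mem_filter.2 ⟨hk, hmax⟩⟩
      obtain ⟨hA, hmax⟩ := Finset.mem_filter.1 (hpick t s _ hne)
      have e1 := hmax k₀ hmem
      have e2 := hupper k₀
      have e3 := hlower (I.pick t s {k ∈ A | ∀ k' ∈ A, I.ucb (Ψ s) a y t k' ≤ I.ucb (Ψ s) a y t k})
      have e4 := h1 _ hA
      dsimp only
      linarith
    · obtain ⟨k, hk, hlt⟩ := by simpa only [not_forall, not_le] using h1
      have e0 : (2 : ℝ) ^ (1 - (s : ℤ)) = 2 * 2 ^ (-(s : ℤ)) := by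
        rw [sub_eq_add_neg, zpow_add₀ two_ne_zero, zpow_one]
      have e1 : (2 : ℝ) ^ (-(s : ℤ)) = 2 * 2 ^ (-((s + 1 : ℕ) : ℤ)) := by
        rw [← zpow_one_add₀ two_ne_zero]
        congr 1
        push_cast
        ring
      refine ih (s + 1) _ (Or.inr (four_pow_lt hT (hlt.trans_le (h2 k hk)))) (by omega)
        (by omega) ?_ ?_
      -- The best item is never eliminated: its upper bound is at least v k₀ ≥ v k', and the upper
      -- bound of k' exceeds v k' by at most 2·2^(-s).
      · refine Finset.mem_filter.2 ⟨hmem, fun k' hk' => ?_⟩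
        have := hlower k'
        have := h2 k' hk'
        have := hupper k₀
        have := hk₀ k'
        rw [e0]
        linarith
      -- A survivor loses at most 2·2^(-s) by the elimination threshold and 2·2^(-s) by its own
      -- confidence interval. The total 4·2^(-s) equals 8·2^(-(s+1)), the invariant of the next
      -- level.
      · intro k' hk'
        obtain ⟨hA, hmax⟩ := Finset.mem_filter.1 hk'
        have := hmax k₀ hmem
        have := hlower k'
        have := h2 k' hA
        have := hupper k₀
        rw [e0] at *
        linarith
    · refine ⟨fun h => by simp at h, fun s' h => ?_⟩
      simp only [Option.some.injEq] at h
      subst h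
      have hne : ({k ∈ A | (2 : ℝ) ^ (-(s : ℤ)) < I.width (Ψ s) a t k} : Finset _).Nonempty := by
        obtain ⟨k, hk, hlt⟩ := by simpa only [not_forall, not_le] using h2
        exact ⟨k, Finset.mem_filter.2 ⟨hk, hlt⟩⟩
      exact hgap _ (Finset.mem_filter.1 (hpick t s _ hne)).1

/-! ### The whole run -/

/-- The decision that SupREN takes at round `t`. -/
noncomputable def action (I : RENInput d K) (ρ : ℕ → Fin K → ℝ) (t : ℕ) : Option ℕ × Fin K :=
  I.decision ρ t (I.run ρ (t - 1))

/-- Reduces the memory to the decisions of single rounds; it follows that index sets grow with t and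
that different levels are disjoint. -/
theorem mem_run_index (I : RENInput d K) (ρ : ℕ → Fin K → ℝ) (t s τ : ℕ) :
    τ ∈ (I.run ρ t).Ψ s ↔ τ ∈ Finset.Icc 1 t ∧ (I.action ρ τ).1 = some s := by
  induction t with
  | zero => simp [run]
  | succ t ih =>
    have hsplit : τ ∈ Finset.Icc 1 (t + 1) ↔ τ = t + 1 ∨ τ ∈ Finset.Icc 1 t := by
      simp only [Finset.mem_Icc]; omega
    have hnot : t + 1 ∉ Finset.Icc 1 t := by simp
    have hact : I.action ρ (t + 1) = I.decision ρ (t + 1) (I.run ρ t) := rfl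
    rw [hsplit, run, update, ← hact]
    rcases h : (I.action ρ (t + 1)).1 with _ | s'
    · simp only [ih]
      constructor
      · exact fun h' => ⟨Or.inr h'.1, h'.2⟩
      · rintro ⟨rfl | h1, h2⟩
        · simp [h] at h2
        · exact ⟨h1, h2⟩
    · simp only
      by_cases hs : s = s'
      · subst hs
        rw [Function.update_self, Finset.mem_insert, ih]
        constructor
        · rintro (rfl | h')
          · exact ⟨Or.inl rfl, h⟩
          · exact ⟨Or.inr h'.1, h'.2⟩
        · rintro ⟨rfl | h1, h2⟩
          · exact Or.inl rfl
          · exact Or.inr ⟨h1, h2⟩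
      · rw [Function.update_of_ne hs, ih]
        constructor
        · exact fun h' => ⟨Or.inr h'.1, h'.2⟩
        · rintro ⟨rfl | h1, h2⟩
          · rw [h, Option.some.injEq] at h2
            exact absurd h2.symm hs
          · exact ⟨h1, h2⟩

theorem run_item (I : RENInput d K) (ρ : ℕ → Fin K → ℝ) (t τ : ℕ) (hτ : τ ∈ Finset.Icc 1 t) :
    (I.run ρ t).item τ = (I.action ρ τ).2 := by
  induction t with
  | zero => simp at hτ
  | succ t ih =>
    rw [run, update]
    simp only
    by_cases h : τ = t + 1
    · subst h
      rw [Function.update_self]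
      rfl
    · rw [Function.update_of_ne h]
      refine ih ?_
      simp only [Finset.mem_Icc] at hτ ⊢
      omega

theorem chosen_eq (I : RENInput d K) (ρ : ℕ → Fin K → ℝ) (t : ℕ) (ht : 1 ≤ t) :
    I.chosen ρ t = (I.action ρ t).2 :=
  I.run_item ρ t t (Finset.mem_Icc.2 ⟨ht, le_rfl⟩)

/-- The decisions up to round `t + 1` depend on the rewards of the first `t` rounds only. -/
theorem run_congr (I : RENInput d K) {ρ ρ' : ℕ → Fin K → ℝ} (t : ℕ)
    (h : ∀ τ ∈ Finset.Icc 1 t, ρ τ = ρ' τ) : I.run ρ (t + 1) = I.run ρ' (t + 1) := by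
  induction t with
  | zero =>
    rw [run, run, run, run, decision, decision]
    congr 1
    exact I.selectFrom_congr _ _ _ _ _ _ fun s τ hτ => by simp at hτ
  | succ t ih =>
    have hr := ih fun τ hτ => h τ (Finset.Icc_subset_Icc_right (Nat.le_succ t) hτ)
    change update (t + 2) (I.run ρ (t + 1)) (I.decision ρ (t + 2) (I.run ρ (t + 1)))
      = update (t + 2) (I.run ρ' (t + 1)) (I.decision ρ' (t + 2) (I.run ρ' (t + 1)))
    rw [← hr, decision, decision]
    congr 1
    exact I.selectFrom_congr _ _ _ _ _ _ fun s τ hτ => by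
      rw [h τ ((I.mem_run_index ρ (t + 1) s τ).1 hτ).1]

/-- The index sets of the levels up to `s`, and the items chosen at the rounds in them, depend
on the rewards received on the levels below `s` only. -/
theorem run_level_congr (I : RENInput d K) {ρ ρ' : ℕ → Fin K → ℝ} (t s : ℕ)
    (h : ∀ s' < s, ∀ τ ∈ (I.run ρ t).Ψ s', ρ τ = ρ' τ) :
    ∀ s' ≤ s, (I.run ρ t).Ψ s' = (I.run ρ' t).Ψ s' ∧
      ∀ τ ∈ (I.run ρ t).Ψ s', (I.run ρ t).item τ = (I.run ρ' t).item τ := by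
  induction t with
  | zero => exact fun s' _ => ⟨rfl, fun τ hτ => by simp [run] at hτ⟩
  | succ t ih =>
    have hmono : ∀ (ρ : ℕ → Fin K → ℝ) s', (I.run ρ t).Ψ s' ⊆ (I.run ρ (t + 1)).Ψ s' := by
      intro ρ s' τ hτ
      rw [mem_run_index] at hτ ⊢
      exact ⟨Finset.Icc_subset_Icc_right (Nat.le_succ t) hτ.1, hτ.2⟩
    have ih' := ih fun s' hs' τ hτ => h s' hs' τ (hmono ρ s' hτ)
    have hact : I.action ρ (t + 1) = I.action ρ' (t + 1) ∨
        (∀ s' ≤ s, (I.action ρ (t + 1)).1 ≠ some s') ∧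
        (∀ s' ≤ s, (I.action ρ' (t + 1)).1 ≠ some s') := by
      -- Levels start at 1, so for s = 0 neither decision can add a round to a level up to s.
      rcases Nat.eq_zero_or_pos s with rfl | hs
      · right
        constructor <;> intro s' hs' h' <;>
          have := I.selectFrom_level_ge _ _ _ _ _ _ _ _ h' <;> omega
      · refine I.selectFrom_eq_or (t + 1) I.T s 1 Finset.univ hs (fun s' hs' => (ih' s' hs').1)
          (fun s' hs' => (ih' s' hs').2) fun s' hs' τ hτ => ?_
        show ρ τ _ = ρ' τ _
        rw [Nat.add_sub_cancel] at hτ ⊢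
        rw [← (ih' s' hs'.le).2 τ hτ, h s' hs' τ (hmono ρ s' hτ)]
    intro s' hs'
    have hiff : ∀ τ ∈ Finset.Icc 1 (t + 1),
        ((I.action ρ τ).1 = some s' ↔ (I.action ρ' τ).1 = some s') ∧
        ((I.action ρ τ).1 = some s' → (I.action ρ τ).2 = (I.action ρ' τ).2) := by
      intro τ hτ
      by_cases hlt : τ = t + 1
      · subst hlt
        rcases hact with e | ⟨e1, e2⟩
        · rw [e]; simp
        · exact ⟨iff_of_false (e1 s' hs') (e2 s' hs'), fun e => absurd e (e1 s' hs')⟩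
      · have hτ' : τ ∈ Finset.Icc 1 t := by
          simp only [Finset.mem_Icc] at hτ ⊢; omega
        obtain ⟨f1, f2⟩ := ih' s' hs'
        have g : ∀ ρ : ℕ → Fin K → ℝ, (I.action ρ τ).1 = some s' ↔ τ ∈ (I.run ρ t).Ψ s' :=
          fun ρ => by rw [mem_run_index]; simp [hτ']
        rw [g, g, f1, ← I.run_item ρ t τ hτ', ← I.run_item ρ' t τ hτ']
        exact ⟨Iff.rfl, fun e => f2 τ (f1 ▸ e)⟩
    constructor
    · ext τ
      rw [mem_run_index, mem_run_index]
      exact and_congr_right fun hτ => (hiff τ hτ).1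
    · intro τ hτ
      rw [mem_run_index] at hτ
      rw [I.run_item _ _ _ hτ.1, I.run_item _ _ _ hτ.1]
      exact (hiff τ hτ.1).2 hτ.2

/-! ### Measurability -/

theorem measurable_estimate (I : RENInput d K) (Ψ : Finset ℕ) (a : ℕ → Fin K) (t : ℕ)
    (k : Fin K) : Measurable fun ρ : ℕ → Fin K → ℝ => I.estimate Ψ a (fun τ => ρ τ (a τ)) t k := by
  simp only [estimate, dotProduct_gram_inv, response, dotProduct_sum, dotProduct_smul, smul_eq_mul]
  fun_prop

theorem measurable_ucb (I : RENInput d K) (Ψ : Finset ℕ) (a : ℕ → Fin K) (t : ℕ)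
    (k : Fin K) : Measurable fun ρ : ℕ → Fin K → ℝ => I.ucb Ψ a (fun τ => ρ τ (a τ)) t k :=
  (I.measurable_estimate Ψ a t k).add_const _

/-- The case distinctions involve only widths, which do not depend on `ρ`. Rewards enter through the
filtered candidate set alone, and this set has finitely many possible values. -/
theorem measurableSet_selectFrom_eq (I : RENInput d K) (Ψ : ℕ → Finset ℕ) (a : ℕ → Fin K)
    (t n s : ℕ) (A : Finset (Fin K)) (c : Option ℕ × Fin K) :
    MeasurableSet {ρ : ℕ → Fin K → ℝ | I.selectFrom Ψ a (fun τ => ρ τ (a τ)) t n s A = c} := by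
  induction n generalizing s A with
  | zero => simp only [selectFrom]; exact MeasurableSet.const _
  | succ n ih =>
    -- The offset `e` is 0 for the maximizers in case (a) and 2^(1-s) for the elimination in case
    -- (b).
    have hfilter : ∀ (e : ℝ) (B : Finset (Fin K)), MeasurableSet {ρ : ℕ → Fin K → ℝ |
        {k ∈ A | ∀ k' ∈ A, I.ucb (Ψ s) a (fun τ => ρ τ (a τ)) t k' - e
          ≤ I.ucb (Ψ s) a (fun τ => ρ τ (a τ)) t k} = B} := by
      intro e B
      simp only [Finset.ext_iff, Finset.mem_filter]
      refine measurableSet_setOfPred.2 (Measurable.forall fun k => ?_)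
      refine Measurable.iff (Measurable.and measurable_const ?_) measurable_const
      refine Measurable.forall fun k' => Measurable.imp measurable_const ?_
      exact measurableSet_setOfPred.1 (measurableSet_le ((I.measurable_ucb _ _ _ _).sub_const _)
        (I.measurable_ucb _ _ _ _))
    have hsplit : ∀ (F : Finset (Fin K) → (ℕ → Fin K → ℝ) → Option ℕ × Fin K) (e : ℝ),
        (∀ B, MeasurableSet {ρ | F B ρ = c}) →
        MeasurableSet {ρ : ℕ → Fin K → ℝ | F {k ∈ A | ∀ k' ∈ A,
          I.ucb (Ψ s) a (fun τ => ρ τ (a τ)) t k' - e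
            ≤ I.ucb (Ψ s) a (fun τ => ρ τ (a τ)) t k} ρ = c} := by
      intro F e hF
      have : {ρ : ℕ → Fin K → ℝ | F {k ∈ A | ∀ k' ∈ A,
          I.ucb (Ψ s) a (fun τ => ρ τ (a τ)) t k' - e
            ≤ I.ucb (Ψ s) a (fun τ => ρ τ (a τ)) t k} ρ = c}
          = ⋃ B : Finset (Fin K), {ρ : ℕ → Fin K → ℝ |
        {k ∈ A | ∀ k' ∈ A, I.ucb (Ψ s) a (fun τ => ρ τ (a τ)) t k' - e
          ≤ I.ucb (Ψ s) a (fun τ => ρ τ (a τ)) t k} = B} ∩ {ρ | F B ρ = c} := by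
        ext ρ
        simp
      rw [this]
      exact MeasurableSet.iUnion fun B => (hfilter e B).inter (hF B)
    simp only [selectFrom]
    split_ifs with h1 h2
    · have := hsplit (fun B _ => (none, I.pick t s B)) 0 fun B => MeasurableSet.const _
      simpa only [sub_zero] using this
    · exact hsplit (fun B ρ => I.selectFrom Ψ a (fun τ => ρ τ (a τ)) t n (s + 1) B) _ (ih (s + 1))
    · exact MeasurableSet.const _

/-- The type of memories is uncountable, but only countably many memories can be reached after t
rounds, so it suffices to treat single values. -/
theorem measurableSet_run_mem (I : RENInput d K) (t : ℕ) (S : Set (Memory K)) :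
    MeasurableSet {ρ : ℕ → Fin K → ℝ | I.run ρ t ∈ S} := by
  suffices h : ∃ C : Set (Memory K), C.Countable ∧ (∀ ρ, I.run ρ t ∈ C) ∧
      ∀ m, MeasurableSet {ρ : ℕ → Fin K → ℝ | I.run ρ t = m} by
    obtain ⟨C, hC, hmem, hm⟩ := h
    have : {ρ : ℕ → Fin K → ℝ | I.run ρ t ∈ S} = ⋃ m ∈ C ∩ S, {ρ | I.run ρ t = m} := by
      ext ρ
      simp [hmem ρ]
    rw [this]
    exact MeasurableSet.biUnion (hC.mono Set.inter_subset_left) fun m _ => hm m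
  induction t with
  | zero => exact ⟨{I.run 0 0}, Set.countable_singleton _, fun ρ => rfl,
      fun m => MeasurableSet.const (I.run 0 0 = m)⟩
  | succ t ih =>
    obtain ⟨C, hC, hmem, hm⟩ := ih
    refine ⟨Set.image2 (update (t + 1)) C Set.univ, hC.image2 Set.countable_univ _,
      fun ρ => Set.mem_image2_of_mem (hmem ρ) (Set.mem_univ _), fun m => ?_⟩
    have : {ρ : ℕ → Fin K → ℝ | I.run ρ (t + 1) = m} = ⋃ m' ∈ C, ⋃ c : Option ℕ × Fin K,
        {ρ | I.run ρ t = m'} ∩ ({ρ | I.decision ρ (t + 1) m' = c}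
          ∩ {_ρ | update (t + 1) m' c = m}) := by
      ext ρ
      simp only [Set.mem_iUnion, Set.mem_inter_iff, Set.mem_ofPred_eq, run]
      constructor
      · exact fun h => ⟨_, hmem ρ, _, rfl, rfl, h⟩
      · rintro ⟨m', -, c, rfl, rfl, h⟩
        exact h
    rw [this]
    refine MeasurableSet.biUnion hC fun m' _ => MeasurableSet.iUnion fun c => ?_
    exact (hm m').inter ((I.measurableSet_selectFrom_eq _ _ _ _ _ _ c).inter (MeasurableSet.const _))

theorem measurable_chosen (I : RENInput d K) (t : ℕ) :
    Measurable fun ρ : ℕ → Fin K → ℝ => I.chosen ρ t :=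
  measurable_to_countable' fun k => I.measurableSet_run_mem t {m | m.item t = k}

/-! ### The history of one level -/

/-- The rounds in the index set of level `s` after `t` rounds, with the items chosen there. -/
noncomputable def history (I : RENInput d K) (ρ : ℕ → Fin K → ℝ) (t s : ℕ) :
    Finset (ℕ × Fin K) :=
  ((I.run ρ t).Ψ s).image fun τ => (τ, (I.run ρ t).item τ)

theorem image_fst_history (I : RENInput d K) (ρ : ℕ → Fin K → ℝ) (t s : ℕ) :
    (I.history ρ t s).image Prod.fst = (I.run ρ t).Ψ s := by
  rw [history, Finset.image_image]
  exact Finset.image_id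

theorem item_eq_of_history_eq (I : RENInput d K) {ρ ρ' : ℕ → Fin K → ℝ} {t s : ℕ}
    (h : I.history ρ t s = I.history ρ' t s) :
    ∀ τ ∈ (I.run ρ t).Ψ s, (I.run ρ t).item τ = (I.run ρ' t).item τ := by
  intro τ hτ
  have h1 : (τ, (I.run ρ t).item τ) ∈ I.history ρ' t s := by
    rw [← h]
    exact Finset.mem_image_of_mem _ hτ
  obtain ⟨u, -, hu⟩ := Finset.mem_image.1 h1
  simp only [Prod.mk.injEq] at hu
  rw [← hu.2, hu.1]

/-- The history of a level does not depend on the rewards received on that level. -/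
theorem history_congr (I : RENInput d K) {ρ ρ' : ℕ → Fin K → ℝ} {t s : ℕ}
    (h : ∀ τ ∈ Finset.Icc 1 t, τ ∉ (I.history ρ t s).image Prod.fst → ρ τ = ρ' τ) :
    I.history ρ' t s = I.history ρ t s := by
  obtain ⟨h1, h2⟩ := I.run_level_congr t s (ρ := ρ) (ρ' := ρ') (fun s' hs' τ hτ => by
    rw [mem_run_index] at hτ
    refine h τ hτ.1 fun hmem => ?_
    rw [image_fst_history, mem_run_index, hτ.2] at hmem
    exact hs'.ne (Option.some.inj hmem.2)) s le_rfl
  rw [history, history, ← h1]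
  exact Finset.image_congr fun τ hτ => by rw [h2 τ hτ]

theorem measurableSet_history_eq (I : RENInput d K) (t s : ℕ) (F : Finset (ℕ × Fin K)) :
    MeasurableSet {ρ : ℕ → Fin K → ℝ | I.history ρ t s = F} :=
  I.measurableSet_run_mem t {m | ((m.Ψ s).image fun τ => (τ, m.item τ)) = F}

/-- The rewards of the rounds in `B`, the other ones being replaced by `0`. -/
def restrictTo (B : Finset ℕ) (ρ : ℕ → Fin K → ℝ) : ℕ → Fin K → ℝ :=
  fun τ => if τ ∈ B then ρ τ else 0

/-- The event that the history equals F is thus determined by the rewards at rounds outside F, which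
makes it independent of the rewards at the rounds of F. -/
theorem history_restrictTo_eq_iff (I : RENInput d K) {ρ : ℕ → Fin K → ℝ} {t s n : ℕ} (ht : t ≤ n)
    (F : Finset (ℕ × Fin K)) :
    I.history (restrictTo (Finset.Icc 1 n \ F.image Prod.fst) ρ) t s = F
      ↔ I.history ρ t s = F := by
  have hr : ∀ τ ∈ Finset.Icc 1 t, τ ∉ F.image Prod.fst →
      ρ τ = restrictTo (Finset.Icc 1 n \ F.image Prod.fst) ρ τ := by
    intro τ h1 h2
    rw [restrictTo, if_pos (Finset.mem_sdiff.2 ⟨Finset.Icc_subset_Icc_right ht h1, h2⟩)]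
  constructor
  · intro h
    rw [← h]
    exact I.history_congr fun τ h1 h2 => (hr τ h1 (h ▸ h2)).symm
  · intro h
    conv_rhs => rw [← h]
    exact I.history_congr fun τ h1 h2 => hr τ h1 (h ▸ h2)

end RENInput

namespace RENInput

variable {d K : ℕ}

/-! ### The regret with respect to the means of the contexts -/

/-- The confidence bound of level `s` for item `k` fails at round `t`. -/
def ConfidenceFails (I : RENInput d K) (θ : EuclideanSpace ℝ (Fin d)) (ρ : ℕ → Fin K → ℝ)
    (t s : ℕ) (k : Fin K) : Prop :=
  (I.α + 1) * I.spread ((I.run ρ (t - 1)).Ψ s) (I.run ρ (t - 1)).item t k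
    < |I.estimate ((I.run ρ (t - 1)).Ψ s) (I.run ρ (t - 1)).item
        (fun τ => ρ τ ((I.run ρ (t - 1)).item τ)) t k - inner ℝ (I.μ t k) θ|

/-- The number of levels that SupREN uses. -/
def levels (I : RENInput d K) : ℕ := Nat.log 4 I.T + 1

theorem mem_levels (I : RENInput d K) {s : ℕ} (h1 : 1 ≤ s) (hs : s = 1 ∨ 4 ^ (s - 1) < I.T) :
    s ∈ Finset.Icc 1 I.levels := by
  rw [Finset.mem_Icc, levels]
  refine ⟨h1, ?_⟩
  rcases hs with rfl | hs
  · omega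
  · have := Nat.le_log_of_pow_le (by norm_num) hs.le
    omega

theorem abs_mean_le {x θ : EuclideanSpace ℝ (Fin d)} (hx : ‖x‖ ≤ 1) (hθ : ‖θ‖ ≤ 1) :
    |inner ℝ x θ| ≤ 1 :=
  (abs_real_inner_le_norm x θ).trans (mul_le_one₀ hx (norm_nonneg _) hθ)

/-- The j-th smallest element is at least j, and 1/√j ≤ 2(√j − √(j−1)) telescopes. -/
theorem sum_one_div_sqrt_le (Ψ : Finset ℕ) (h : ∀ t ∈ Ψ, 1 ≤ t) :
    ∑ t ∈ Ψ, 1 / Real.sqrt t ≤ 2 * Real.sqrt Ψ.card := by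
  induction Ψ using Finset.induction_on_max with
  | empty => simp
  | insert t Ψ hlt ih =>
    have ht : t ∉ Ψ := fun hmem => lt_irrefl _ (hlt t hmem)
    have hcard : Ψ.card + 1 ≤ t := by
      have hsub : Ψ ⊆ Finset.Icc 1 (t - 1) := fun u hu => by
        have := hlt u hu
        have := h u (Finset.mem_insert_of_mem hu)
        rw [Finset.mem_Icc]; omega
      have := Finset.card_le_card hsub
      have := h t (Finset.mem_insert_self t Ψ)
      rw [Nat.card_Icc] at *
      omega
    rw [Finset.sum_insert ht, Finset.card_insert_of_notMem ht]
    have ih' := ih fun u hu => h u (Finset.mem_insert_of_mem hu)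
    have h1 : 1 / Real.sqrt t ≤ 1 / Real.sqrt ((Ψ.card + 1 : ℕ) : ℝ) := by
      refine one_div_le_one_div_of_le (Real.sqrt_pos.2 (by positivity)) ?_
      exact Real.sqrt_le_sqrt (by exact_mod_cast hcard)
    have h2 : 1 / Real.sqrt ((Ψ.card + 1 : ℕ) : ℝ)
        ≤ 2 * (Real.sqrt ((Ψ.card + 1 : ℕ) : ℝ) - Real.sqrt Ψ.card) := by
      have p : 0 < Real.sqrt ((Ψ.card + 1 : ℕ) : ℝ) := Real.sqrt_pos.2 (by positivity)
      have q : 0 ≤ Real.sqrt (Ψ.card : ℝ) := Real.sqrt_nonneg _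
      have e1 : Real.sqrt ((Ψ.card + 1 : ℕ) : ℝ) ^ 2 = Ψ.card + 1 := by
        rw [Real.sq_sqrt (by positivity)]; push_cast; rfl
      have e2 : Real.sqrt (Ψ.card : ℝ) ^ 2 = Ψ.card := Real.sq_sqrt (by positivity)
      rw [div_le_iff₀ p]
      nlinarith [sq_nonneg (Real.sqrt ((Ψ.card + 1 : ℕ) : ℝ) - Real.sqrt (Ψ.card : ℝ))]
    linarith

section Deterministic

variable (I : RENInput d K) (ρ : ℕ → Fin K → ℝ)

theorem run_index_before {n t : ℕ} (s : ℕ) (ht : t ∈ Finset.Icc 1 n) :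
    (I.run ρ (t - 1)).Ψ s = {τ ∈ (I.run ρ n).Ψ s | τ < t} := by
  ext τ
  simp only [mem_run_index, Finset.mem_filter, Finset.mem_Icc] at ht ⊢
  constructor
  · rintro ⟨⟨h1, h2⟩, h3⟩
    exact ⟨⟨⟨h1, by omega⟩, h3⟩, by omega⟩
  · rintro ⟨⟨⟨h1, h2⟩, h3⟩, h4⟩
    exact ⟨⟨h1, by omega⟩, h3⟩

theorem action_some (hpick : ∀ t s A, A.Nonempty → I.pick t s A ∈ A) (hT : 1 ≤ I.T) {t s : ℕ}
    (h : (I.action ρ t).1 = some s) :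
    s ∈ Finset.Icc 1 I.levels ∧ (2 : ℝ) ^ (-(s : ℤ))
      < I.width ((I.run ρ (t - 1)).Ψ s) (I.run ρ (t - 1)).item t (I.action ρ t).2 := by
  obtain ⟨h1, h2⟩ := I.selectFrom_some _ _ _ hpick hT t I.T 1 Finset.univ (Or.inl rfl) s h
  exact ⟨I.mem_levels (I.selectFrom_level_ge _ _ _ _ _ _ _ _ h) h1, h2⟩

/-- The size of the index set of level `s`. -/
theorem card_index_le (hpick : ∀ t s A, A.Nonempty → I.pick t s A ∈ A) (hT : 1 ≤ I.T)
    (hα : 0 ≤ I.α) (hμ : ∀ t ∈ Finset.Icc 1 I.T, ∀ k, ‖I.μ t k‖ ≤ 1)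
    (hσ : ∀ t ∈ Finset.Icc 1 I.T, ∀ k, ‖I.σ t k‖ ≤ 1 / Real.sqrt t) (s : ℕ) :
    (2 : ℝ) ^ (-(s : ℤ)) * ((I.run ρ I.T).Ψ s).card
      ≤ ((I.α + 1) * Real.sqrt (2 * d * Real.log (1 + I.T))
          + 2 * (4 * Real.sqrt d + 2 * Real.sqrt (Real.log (I.T * K / I.δ))))
        * Real.sqrt ((I.run ρ I.T).Ψ s).card := by
  set Ψ := (I.run ρ I.T).Ψ s with hΨ
  set a := (I.run ρ I.T).item with ha
  set c := 4 * Real.sqrt d + 2 * Real.sqrt (Real.log (I.T * K / I.δ)) with hc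
  have hc0 : 0 ≤ c := by positivity
  have hsub : Ψ ⊆ Finset.Icc 1 I.T := fun t ht => ((I.mem_run_index ρ I.T s t).1 ht).1
  have hcard : (Ψ.card : ℝ) ≤ I.T := by
    have := Finset.card_le_card hsub
    rw [Nat.card_Icc, Nat.add_sub_cancel] at this
    exact_mod_cast this
  -- A round enters the level only with width above 2^(-s); summing this over the level turns bounds
  -- on the widths into a bound on its size.
  have hwidth : ∀ t ∈ Ψ, (2 : ℝ) ^ (-(s : ℤ))
      ≤ (I.α + 1) * I.spread {τ ∈ Ψ | τ < t} a t (a t) + c * (1 / Real.sqrt t) := by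
    intro t ht
    have htI := hsub ht
    have hlt := (I.action_some ρ hpick hT ((I.mem_run_index ρ I.T s t).1 ht).2).2
    rw [← I.run_item ρ I.T t htI, I.run_index_before ρ s htI, I.width_congr (a' := a), width] at hlt
    · refine hlt.le.trans (add_le_add le_rfl ?_)
      exact mul_le_mul_of_nonneg_left (hσ t htI _) hc0
    · intro τ hτ
      obtain ⟨h1, h2⟩ := Finset.mem_filter.1 hτ
      have h3 := Finset.mem_Icc.1 (hsub h1)
      rw [ha, I.run_item ρ _ _ (hsub h1), I.run_item ρ _ _ (Finset.mem_Icc.2 ⟨h3.1, by omega⟩)]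
  have hsum := Finset.sum_le_sum hwidth
  rw [Finset.sum_const, nsmul_eq_mul, Finset.sum_add_distrib, ← Finset.mul_sum,
    ← Finset.mul_sum] at hsum
  have h1 := I.sum_spread_le Ψ a fun t ht => hμ t (hsub ht) _
  have h2 := sum_one_div_sqrt_le Ψ fun t ht => (Finset.mem_Icc.1 (hsub ht)).1
  have h3 : Real.sqrt (2 * d * Real.log (1 + Ψ.card)) ≤ Real.sqrt (2 * d * Real.log (1 + I.T)) := by
    refine Real.sqrt_le_sqrt (mul_le_mul_of_nonneg_left ?_ (by positivity))
    exact Real.log_le_log (by positivity) (by linarith)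
  calc _ = Ψ.card * (2 : ℝ) ^ (-(s : ℤ)) := mul_comm _ _
    _ ≤ _ := hsum
    _ ≤ (I.α + 1) * (Real.sqrt Ψ.card * Real.sqrt (2 * d * Real.log (1 + I.T)))
        + c * (2 * Real.sqrt Ψ.card) := by
      refine add_le_add (mul_le_mul_of_nonneg_left (h1.trans ?_) (by linarith))
        (mul_le_mul_of_nonneg_left h2 hc0)
      exact mul_le_mul_of_nonneg_left h3 (Real.sqrt_nonneg _)
    _ = _ := by ring

/-- Cauchy–Schwarz; the index sets are disjoint subsets of the T rounds. -/
theorem sum_sqrt_card_le (n : ℕ) :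
    ∑ s ∈ Finset.Icc 1 n, Real.sqrt ((I.run ρ I.T).Ψ s).card ≤ Real.sqrt (n * I.T) := by
  refine Real.le_sqrt_of_sq_le (sq_sum_le_card_mul_sum_sq.trans ?_)
  rw [Nat.card_Icc, Nat.add_sub_cancel]
  refine mul_le_mul_of_nonneg_left ?_ (by positivity)
  simp_rw [Real.sq_sqrt (Nat.cast_nonneg _)]
  rw [← Nat.cast_sum, ← Finset.card_biUnion]
  · have : ((Finset.Icc 1 n).biUnion (I.run ρ I.T).Ψ).card ≤ (Finset.Icc 1 I.T).card := by
      refine Finset.card_le_card (Finset.biUnion_subset.2 fun s _ t ht => ?_)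
      exact ((I.mem_run_index ρ I.T s t).1 ht).1
    rw [Nat.card_Icc, Nat.add_sub_cancel] at this
    exact_mod_cast this
  · intro s _ s' _ hne
    refine Finset.disjoint_left.2 fun t h1 h2 => hne ?_
    rw [mem_run_index] at h1 h2
    exact Option.some.inj (h1.2.symm.trans h2.2)

open Classical in
-- Means lie in [−1, 1], so a round with a failing bound costs at most 2. On the other rounds
-- `selectFrom_gap` applies, and its hypothesis at level 1 holds because 2 ≤ 8·2^(-1).
theorem gap_le (hpick : ∀ t s A, A.Nonempty → I.pick t s A ∈ A) (hT : 1 ≤ I.T)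
    (θ : EuclideanSpace ℝ (Fin d)) (hθ : ‖θ‖ ≤ 1)
    (hμ : ∀ t ∈ Finset.Icc 1 I.T, ∀ k, ‖I.μ t k‖ ≤ 1) (t : ℕ) (ht : t ∈ Finset.Icc 1 I.T)
    (k₀ : Fin K) (hk₀ : ∀ k, inner ℝ (I.μ t k) θ ≤ inner ℝ (I.μ t k₀) θ) :
    inner ℝ (I.μ t k₀) θ - inner ℝ (I.μ t (I.chosen ρ t)) θ
      ≤ 2 * (if ∃ s ∈ Finset.Icc 1 I.levels, ∃ k, I.ConfidenceFails θ ρ t s k then 1 else 0)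
        + 2 * (1 / Real.sqrt I.T)
        + ∑ s ∈ Finset.Icc 1 I.levels,
            8 * (2 : ℝ) ^ (-(s : ℤ)) * (if (I.action ρ t).1 = some s then 1 else 0) := by
  rw [I.chosen_eq ρ t (Finset.mem_Icc.1 ht).1]
  have hnn : ∀ s ∈ Finset.Icc 1 I.levels,
      0 ≤ 8 * (2 : ℝ) ^ (-(s : ℤ)) * (if (I.action ρ t).1 = some s then (1 : ℝ) else 0) :=
    fun s _ => mul_nonneg (by positivity) (by split_ifs <;> norm_num)
  have hnn' := Finset.sum_nonneg hnn
  have hsq : 0 ≤ 1 / Real.sqrt I.T := by positivity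
  have hb : ∀ k, inner ℝ (I.μ t k₀) θ - inner ℝ (I.μ t k) θ ≤ 2 := fun k => by
    have h1 := abs_le.1 (abs_mean_le (hμ t ht k₀) hθ)
    have h2 := abs_le.1 (abs_mean_le (hμ t ht k) hθ)
    linarith
  split_ifs with hf
  · have := hb (I.action ρ t).2
    linarith
  · have hconf : ∀ s, 1 ≤ s → (s = 1 ∨ 4 ^ (s - 1) < I.T) → ∀ k,
        |I.estimate ((I.run ρ (t - 1)).Ψ s) (I.run ρ (t - 1)).item
          (fun τ => ρ τ ((I.run ρ (t - 1)).item τ)) t k - inner ℝ (I.μ t k) θ|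
          ≤ I.width ((I.run ρ (t - 1)).Ψ s) (I.run ρ (t - 1)).item t k := by
      intro s h1 hs k
      refine le_trans ?_ (I.spread_le_width _ _ _ _)
      by_contra! hlt
      exact hf ⟨s, I.mem_levels h1 hs, k, hlt⟩
    obtain ⟨g1, g2⟩ := I.selectFrom_gap (I.run ρ (t - 1)).Ψ (I.run ρ (t - 1)).item
      (fun τ => ρ τ ((I.run ρ (t - 1)).item τ)) hpick hT (fun k => inner ℝ (I.μ t k) θ) k₀ hk₀ t
      I.T 1 Finset.univ (Or.inl rfl) (by omega) le_rfl hconf (Finset.mem_univ _)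
      (fun k _ => (hb k).trans (by norm_num))
    rcases h : (I.action ρ t).1 with _ | s
    · have h1 : inner ℝ (I.μ t k₀) θ - inner ℝ (I.μ t (I.action ρ t).2) θ
        ≤ 2 * (1 / Real.sqrt I.T) := g1 h
      simp only [h] at hnn'
      linarith
    · have h1 : inner ℝ (I.μ t k₀) θ - inner ℝ (I.μ t (I.action ρ t).2) θ
        ≤ 8 * (2 : ℝ) ^ (-(s : ℤ)) := g2 s h
      have h2 := Finset.single_le_sum hnn (I.action_some ρ hpick hT h).1
      rw [h] at h2
      simp only [if_true, mul_one] at h2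
      linarith

open Classical in
/-- The regret with respect to the means, in terms of the number of rounds at which a confidence
bound fails. -/
theorem sum_gap_le (hpick : ∀ t s A, A.Nonempty → I.pick t s A ∈ A) (hT : 1 ≤ I.T)
    (hα : 0 ≤ I.α) (θ : EuclideanSpace ℝ (Fin d)) (hθ : ‖θ‖ ≤ 1)
    (hμ : ∀ t ∈ Finset.Icc 1 I.T, ∀ k, ‖I.μ t k‖ ≤ 1)
    (hσ : ∀ t ∈ Finset.Icc 1 I.T, ∀ k, ‖I.σ t k‖ ≤ 1 / Real.sqrt t) (k₀ : ℕ → Fin K)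
    (hk₀ : ∀ t k, inner ℝ (I.μ t k) θ ≤ inner ℝ (I.μ t (k₀ t)) θ) :
    ∑ t ∈ Finset.Icc 1 I.T, (inner ℝ (I.μ t (k₀ t)) θ - inner ℝ (I.μ t (I.chosen ρ t)) θ)
      ≤ 2 * ({t ∈ Finset.Icc 1 I.T |
            ∃ s ∈ Finset.Icc 1 I.levels, ∃ k, I.ConfidenceFails θ ρ t s k}.card : ℝ)
        + 2 * Real.sqrt I.T
        + 8 * (((I.α + 1) * Real.sqrt (2 * d * Real.log (1 + I.T))
          + 2 * (4 * Real.sqrt d + 2 * Real.sqrt (Real.log (I.T * K / I.δ))))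
            * Real.sqrt (I.levels * I.T)) := by
  refine (Finset.sum_le_sum fun t ht =>
    I.gap_le ρ hpick hT θ hθ hμ t ht (k₀ t) (hk₀ t)).trans ?_
  rw [Finset.sum_add_distrib, Finset.sum_add_distrib, ← Finset.mul_sum]
  refine add_le_add (add_le_add (mul_le_mul_of_nonneg_left ?_ zero_le_two) ?_) ?_
  · rw [Finset.card_filter]
    push_cast
    exact (Finset.sum_congr rfl fun _ _ => by congr).le
  · rw [Finset.sum_const, Nat.card_Icc, Nat.add_sub_cancel, nsmul_eq_mul]
    have : (0 : ℝ) < Real.sqrt I.T := Real.sqrt_pos.2 (by exact_mod_cast hT)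
    have h2 := Real.mul_self_sqrt (show (0 : ℝ) ≤ I.T by positivity)
    refine le_of_eq ?_
    nth_rewrite 1 [← h2]
    field_simp
  -- After exchanging the sums, level s contributes 8·2^(-s) times the size of its final index set.
  · rw [Finset.sum_comm]
    have hcard : ∀ s : ℕ, ∑ t ∈ Finset.Icc 1 I.T, 8 * (2 : ℝ) ^ (-(s : ℤ))
        * (if (I.action ρ t).1 = some s then 1 else 0)
          = 8 * ((2 : ℝ) ^ (-(s : ℤ)) * ((I.run ρ I.T).Ψ s).card) := by
      intro s
      rw [← Finset.mul_sum, Finset.sum_boole, mul_assoc]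
      congr 4
      ext t
      rw [mem_run_index, Finset.mem_filter]
    simp_rw [hcard]
    rw [← Finset.mul_sum]
    refine mul_le_mul_of_nonneg_left ?_ (by norm_num)
    refine (Finset.sum_le_sum fun s _ => I.card_index_le ρ hpick hT hα hμ hσ s).trans ?_
    rw [← Finset.mul_sum]
    refine mul_le_mul_of_nonneg_left (I.sum_sqrt_card_le ρ _) ?_
    have : 0 ≤ I.α + 1 := by linarith
    positivity

end Deterministic

end RENInput

/-! ### Probabilistic tools -/

section Tools

variable {Ω : Type*} [MeasurableSpace Ω] {P : Measure Ω}

theorem hasSubgaussianMGF_mono {X : Ω → ℝ} {c c' : NNReal} (h : HasSubgaussianMGF X c P)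
    (hc : c ≤ c') : HasSubgaussianMGF X c' P where
  integrable_exp_mul := h.integrable_exp_mul
  mgf_le t := by
    refine (h.mgf_le t).trans (Real.exp_le_exp.2 ?_)
    have : (c : ℝ) ≤ c' := by exact_mod_cast hc
    gcongr

theorem hasSubgaussianMGF_const_mul {X : Ω → ℝ} {c : NNReal} (h : HasSubgaussianMGF X c P)
    (a : ℝ) : HasSubgaussianMGF (fun ω => a * X ω) (Real.toNNReal (a ^ 2) * c) P := by
  rw [Real.toNNReal_of_nonneg (sq_nonneg a)]
  exact h.const_mul a

/-- A measurable partition into countably many pieces, on each of which an event has conditional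
probability at most `q`. -/
theorem measure_le_of_countable_partition [IsProbabilityMeasure P] {ι : Type*} [Countable ι]
    {g : Ω → ι} (hg : ∀ i, MeasurableSet {ω | g ω = i}) {B : Set Ω} {q : ENNReal}
    (h : ∀ i, P (B ∩ {ω | g ω = i}) ≤ q * P {ω | g ω = i}) : P B ≤ q := by
  have hB : B = ⋃ i, B ∩ {ω | g ω = i} := by ext; simp
  have hU : (Set.univ : Set Ω) = ⋃ i, {ω | g ω = i} := by ext; simp
  calc P B ≤ ∑' i, P (B ∩ {ω | g ω = i}) := by
        conv_lhs => rw [hB]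
        exact measure_iUnion_le _
    _ ≤ ∑' i, q * P {ω | g ω = i} := ENNReal.tsum_le_tsum h
    _ = q * P Set.univ := by
        rw [ENNReal.tsum_mul_left, hU, measure_iUnion _ hg]
        intro i j hij
        refine Set.disjoint_left.2 fun ω h1 h2 => hij ?_
        exact h1.symm.trans h2
    _ = q := by rw [measure_univ, mul_one]

open Classical in
/-- Markov's inequality for the number of events that occur. -/
theorem measure_card_ge_le {ι : Type*} (J : Finset ι) (F : ι → Set Ω) {m : ℕ} (hm : m ≠ 0)
    {q : ENNReal} (hq : ∑ i ∈ J, P (F i) ≤ m * q) :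
    P {ω | m ≤ {i ∈ J | ω ∈ F i}.card} ≤ q := by
  -- The events need not be measurable, so the count is bounded by indicators of their measurable
  -- hulls.
  set f : Ω → ENNReal := fun ω => ∑ i ∈ J, (toMeasurable P (F i)).indicator 1 ω with hf
  have hfm : Measurable f := Finset.measurable_sum _ fun i _ =>
    measurable_one.indicator (measurableSet_toMeasurable _ _)
  have hint : ∫⁻ ω, f ω ∂P = ∑ i ∈ J, P (F i) := by
    rw [hf, lintegral_finsetSum _ fun i _ =>
      measurable_one.indicator (measurableSet_toMeasurable _ _)]
    refine Finset.sum_congr rfl fun i _ => ?_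
    rw [lintegral_indicator_one (measurableSet_toMeasurable _ _), measure_toMeasurable]
  have hsub : {ω | m ≤ {i ∈ J | ω ∈ F i}.card} ⊆ {ω | (m : ENNReal) ≤ f ω} := by
    intro ω hω
    have h1 : ((m : ℕ) : ENNReal) ≤ (({i ∈ J | ω ∈ F i}.card : ℕ) : ENNReal) := by
      exact_mod_cast hω
    refine h1.trans ?_
    rw [Finset.card_filter, hf]
    push_cast
    refine Finset.sum_le_sum fun i _ => ?_
    split_ifs with h
    · rw [Set.indicator_of_mem (subset_toMeasurable _ _ h)]
      exact le_rfl
    · exact zero_le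
  have hm0 : (m : ENNReal) ≠ 0 := by exact_mod_cast hm
  refine (measure_mono hsub).trans
    ((meas_ge_le_lintegral_div hfm.aemeasurable hm0 (ENNReal.natCast_ne_top m)).trans ?_)
  rw [hint]
  exact ENNReal.div_le_of_le_mul' hq

end Tools

/-! ### Independence of the rewards on disjoint sets of rounds -/

namespace RENInput

variable {d K : ℕ}

theorem measurable_restrictTo_apply {Ω : Type*} [MeasurableSpace Ω] {r : ℕ → Fin K → Ω → ℝ}
    {n : ℕ} (hr : ∀ t ∈ Finset.Icc 1 n, ∀ k, Measurable (r t k)) {B : Finset ℕ}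
    (hB : B ⊆ Finset.Icc 1 n) : Measurable fun ω => restrictTo B fun t k => r t k ω := by
  refine measurable_pi_lambda _ fun t => ?_
  by_cases h : t ∈ B
  · simp only [restrictTo, if_pos h]
    exact measurable_pi_lambda _ fun k => hr t (hB h) k
  · simp only [restrictTo, if_neg h]
    exact measurable_const

theorem indepFun_restrictTo {Ω : Type*} [MeasurableSpace Ω] {P : Measure Ω}
    {r : ℕ → Fin K → Ω → ℝ} {n : ℕ} (hr : ∀ t ∈ Finset.Icc 1 n, ∀ k, Measurable (r t k))
    (hind : iIndepFun (fun (t : Finset.Icc 1 n) ω k => r t k ω) P) {B C : Finset ℕ}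
    (hB : B ⊆ Finset.Icc 1 n) (hC : C ⊆ Finset.Icc 1 n) (hBC : Disjoint B C) :
    IndepFun (fun ω => restrictTo B fun t k => r t k ω) (fun ω => restrictTo C fun t k => r t k ω)
      P := by
  let S : Finset ℕ → Finset (Finset.Icc 1 n) := fun B => {i | (i : ℕ) ∈ B}
  have hS : ∀ B, ∀ i, i ∈ S B ↔ (i : ℕ) ∈ B := fun B i => by simp [S]
  -- Extension by zero turns a finite block of rewards into a full reward table.
  let ext : ∀ B : Finset ℕ, B ⊆ Finset.Icc 1 n → ((i : S B) → Fin K → ℝ) → ℕ → Fin K → ℝ :=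
    fun B hB f t => if h : t ∈ B then f ⟨⟨t, hB h⟩, (hS B _).2 h⟩ else 0
  have hext : ∀ B hB, Measurable (ext B hB) := by
    intro B hB
    refine measurable_pi_lambda _ fun t => ?_
    by_cases h : t ∈ B
    · simp only [ext, dif_pos h]
      exact measurable_pi_apply _
    · simp only [ext, dif_neg h]
      exact measurable_const
  have hdis : Disjoint (S B) (S C) := by
    refine Finset.disjoint_left.2 fun i h1 h2 => ?_
    exact Finset.disjoint_left.1 hBC ((hS B i).1 h1) ((hS C i).1 h2)
  have h := (hind.indepFun_finset (S B) (S C) hdis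
    fun i => measurable_pi_lambda _ fun k => hr i i.2 k).comp (hext B hB) (hext C hC)
  have e : ∀ B hB, (ext B hB ∘ fun ω (i : S B) k => r i k ω)
      = fun ω => restrictTo B fun t k => r t k ω := by
    intro B hB
    funext ω t
    by_cases h : t ∈ B <;> simp [ext, restrictTo, h]
  rwa [e, e] at h

/-! ### Failure probability of the confidence bounds -/

section Confidence

variable {Ω : Type*} [MeasurableSpace Ω] {P : Measure Ω} [IsProbabilityMeasure P]
  (I : RENInput d K) (θ : EuclideanSpace ℝ (Fin d)) {r : ℕ → Fin K → Ω → ℝ}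

/-- Hoeffding's inequality for a fixed set of rounds and fixed items. -/
theorem measure_noise_gt_le (hα : 0 ≤ I.α)
    (hind : iIndepFun (fun (t : Finset.Icc 1 I.T) ω k => r t k ω) P)
    (hsub : ∀ t ∈ Finset.Icc 1 I.T, ∀ k,
      HasSubgaussianMGF (fun ω => r t k ω - inner ℝ (I.μ t k) θ) (1 / 4) P)
    {Ψ : Finset ℕ} (hΨ : Ψ ⊆ Finset.Icc 1 I.T) (a : ℕ → Fin K) (t : ℕ) (k : Fin K) :
    P {ω | I.α * I.spread Ψ a t k < |∑ τ ∈ Ψ, (I.dual Ψ a t k ⬝ᵥ (I.μ τ (a τ)).ofLp)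
        * (r τ (a τ) ω - inner ℝ (I.μ τ (a τ)) θ)|}
      ≤ ENNReal.ofReal (2 * Real.exp (-(2 * I.α ^ 2))) := by
  set c : ℕ → ℝ := fun τ => I.dual Ψ a t k ⬝ᵥ (I.μ τ (a τ)).ofLp with hc
  set s := I.spread Ψ a t k with hs
  have hs0 : 0 ≤ s := I.spread_nonneg _ _ _ _
  have hcs : ∑ τ ∈ Ψ, c τ ^ 2 ≤ s ^ 2 := by
    rw [hs, sq_spread]
    exact le_add_of_nonneg_left (Finset.sum_nonneg fun _ _ => mul_self_nonneg _)
  -- If the spread vanishes, all weights vanish and the strict inequality is impossible; the tail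
  -- bound below divides by s².
  rcases hs0.eq_or_lt with h0 | hpos
  · have hzero : ∀ τ ∈ Ψ, c τ = 0 := fun τ hτ => by
      have h1 := (Finset.single_le_sum (fun τ _ => sq_nonneg (c τ)) hτ).trans hcs
      rw [← h0] at h1
      exact pow_eq_zero_iff two_ne_zero |>.1 (le_antisymm (by simpa using h1) (sq_nonneg _))
    have : {ω | I.α * s < |∑ τ ∈ Ψ, c τ * (r τ (a τ) ω - inner ℝ (I.μ τ (a τ)) θ)|} = ∅ := by
      refine Set.eq_empty_of_forall_notMem fun ω hω => ?_
      rw [Set.mem_ofPred_eq, Finset.sum_eq_zero fun τ hτ => by rw [hzero τ hτ, zero_mul], ← h0] at hω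
      simp at hω
    rw [this, measure_empty]
    exact zero_le
  have hX : HasSubgaussianMGF
      (fun ω => ∑ τ ∈ Ψ, c τ * (r τ (a τ) ω - inner ℝ (I.μ τ (a τ)) θ))
      (∑ τ ∈ Ψ, Real.toNNReal (c τ ^ 2) * (1 / 4)) P := by
    have hmap : ∀ i : Finset.Icc 1 I.T, Measurable fun f : Fin K → ℝ =>
        c i * (f (a i) - inner ℝ (I.μ i (a i)) θ) := fun i => by fun_prop
    have h1 := (hind.comp _ hmap)
    have h2 := HasSubgaussianMGF.sum_of_iIndepFun h1
      (c := fun i => Real.toNNReal (c i ^ 2) * (1 / 4))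
      (s := Finset.univ.filter fun i : Finset.Icc 1 I.T => (i : ℕ) ∈ Ψ)
      (fun i _ => hasSubgaussianMGF_const_mul (hsub i i.2 (a i)) (c i))
    have key : ∀ {M : Type} [AddCommMonoid M] (g : ℕ → M),
        ∑ i ∈ Finset.univ.filter (fun i : Finset.Icc 1 I.T => (i : ℕ) ∈ Ψ), g i
          = ∑ τ ∈ Ψ, g τ := by
      intro M _ g
      refine Finset.sum_bij (fun i _ => (i : ℕ)) (fun i hi => (Finset.mem_filter.1 hi).2)
        (fun i _ j _ h => Subtype.ext h) (fun τ hτ => ⟨⟨τ, hΨ hτ⟩, by simpa using hτ, rfl⟩)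
        (fun _ _ => rfl)
    rw [key fun τ => Real.toNNReal (c τ ^ 2) * (1 / 4)] at h2
    refine h2.congr (Filter.Eventually.of_forall fun ω => ?_)
    exact key fun τ => c τ * (r τ (a τ) ω - inner ℝ (I.μ τ (a τ)) θ)
  -- The squared weights sum to at most s², so s²/4 is a variance proxy and the exponent at αs is
  -- (αs)²/(s²/2) = 2α².
  have hX' := hasSubgaussianMGF_mono hX (c' := Real.toNNReal (s ^ 2 / 4)) (by
    rw [← NNReal.coe_le_coe]
    push_cast
    rw [← Finset.sum_mul, Real.coe_toNNReal _ (by positivity),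
      Finset.sum_congr rfl fun τ _ => Real.coe_toNNReal _ (sq_nonneg (c τ))]
    linarith)
  have he : Real.exp (-(I.α * s) ^ 2 / (2 * (s ^ 2 / 4))) = Real.exp (-(2 * I.α ^ 2)) := by
    congr 1
    field_simp
    ring
  have hup := hX'.measure_ge_le (mul_nonneg hα hs0)
  have hlo := hX'.neg.measure_ge_le (mul_nonneg hα hs0)
  rw [Real.coe_toNNReal _ (by positivity), he] at hup hlo
  refine (measure_mono (t := {ω | I.α * s ≤ ∑ τ ∈ Ψ, c τ * (r τ (a τ) ω - inner ℝ (I.μ τ (a τ)) θ)}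
    ∪ {ω | I.α * s ≤ (-fun ω => ∑ τ ∈ Ψ, c τ * (r τ (a τ) ω - inner ℝ (I.μ τ (a τ)) θ)) ω})
    fun ω hω => ?_).trans ((measure_union_le _ _).trans ?_)
  · change I.α * s < |∑ τ ∈ Ψ, c τ * (r τ (a τ) ω - inner ℝ (I.μ τ (a τ)) θ)| at hω
    rcases lt_abs.1 hω with h | h
    · exact Or.inl h.le
    · exact Or.inr h.le
  · rw [two_mul, ENNReal.ofReal_add (Real.exp_pos _).le (Real.exp_pos _).le]
    refine add_le_add ?_ ?_
    · rw [← ofReal_measureReal]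
      exact ENNReal.ofReal_le_ofReal hup
    · rw [← ofReal_measureReal]
      exact ENNReal.ofReal_le_ofReal hlo

/-- The confidence bound of one level for one item fails with probability at most
`2 exp (-2 α ^ 2)`. The rewards received on a level are independent of the history of that level. -/
theorem measure_confidenceFails_le (hα : 0 ≤ I.α) (hθ : ‖θ‖ ≤ 1)
    (hr : ∀ t ∈ Finset.Icc 1 I.T, ∀ k, Measurable (r t k))
    (hind : iIndepFun (fun (t : Finset.Icc 1 I.T) ω k => r t k ω) P)
    (hsub : ∀ t ∈ Finset.Icc 1 I.T, ∀ k,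
      HasSubgaussianMGF (fun ω => r t k ω - inner ℝ (I.μ t k) θ) (1 / 4) P)
    {t : ℕ} (ht : t ≤ I.T) (s : ℕ) (k : Fin K) :
    P {ω | I.ConfidenceFails θ (fun t k => r t k ω) t s k}
      ≤ ENNReal.ofReal (2 * Real.exp (-(2 * I.α ^ 2))) := by
  have ht' : t - 1 ≤ I.T := (Nat.sub_le t 1).trans ht
  have hmeas : ∀ F : Finset (ℕ × Fin K), MeasurableSet
      {ω | I.history (fun t k => r t k ω) (t - 1) s = F} := by
    intro F
    have e : {ω | I.history (fun t k => r t k ω) (t - 1) s = F}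
        = (fun ω => restrictTo (Finset.Icc 1 I.T \ F.image Prod.fst) fun t k => r t k ω) ⁻¹'
          {ρ | I.history ρ (t - 1) s = F} :=
      Set.ext fun ω => (I.history_restrictTo_eq_iff ht' F).symm
    rw [e]
    exact measurable_restrictTo_apply hr Finset.sdiff_subset (I.measurableSet_history_eq _ _ F)
  refine measure_le_of_countable_partition hmeas fun F => ?_
  rcases Set.eq_empty_or_nonempty {ω | I.history (fun t k => r t k ω) (t - 1) s = F} with he | hne
  · rw [he]; simp
  -- Outcomes with history F share the index set of level s and the items chosen there, so the
  -- memory of one of them can replace the random one.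
  obtain ⟨ω₁, hω₁⟩ := hne
  set m := I.run (fun t k => r t k ω₁) (t - 1) with hm
  have hF : F.image Prod.fst = m.Ψ s := by
    rw [← hω₁, image_fst_history]
  have hΨ : m.Ψ s ⊆ Finset.Icc 1 I.T := fun τ hτ =>
    Finset.Icc_subset_Icc_right ht' ((I.mem_run_index _ _ _ _).1 hτ).1
  set D : Set (ℕ → Fin K → ℝ) := {ρ | I.α * I.spread (m.Ψ s) m.item t k
    < |∑ τ ∈ m.Ψ s, (I.dual (m.Ψ s) m.item t k ⬝ᵥ (I.μ τ (m.item τ)).ofLp)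
        * (ρ τ (m.item τ) - inner ℝ (I.μ τ (m.item τ)) θ)|} with hD
  have hDm : MeasurableSet D := by
    refine measurableSet_lt measurable_const ?_
    fun_prop
  have hDr : ∀ ω, restrictTo (m.Ψ s) (fun t k => r t k ω) ∈ D ↔ (fun t k => r t k ω) ∈ D := by
    intro ω
    rw [hD, Set.mem_ofPred_eq, Set.mem_ofPred_eq]
    rw [Finset.sum_congr rfl fun τ hτ => by rw [restrictTo, if_pos hτ]]
  -- One of the α + 1 spreads absorbs the bias, so a failure forces the noise above α spreads. The
  -- two events on the right depend on disjoint sets of rounds.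
  have hsubset : {ω | I.ConfidenceFails θ (fun t k => r t k ω) t s k}
      ∩ {ω | I.history (fun t k => r t k ω) (t - 1) s = F}
      ⊆ ((fun ω => restrictTo (m.Ψ s) fun t k => r t k ω) ⁻¹' D)
        ∩ ((fun ω => restrictTo (Finset.Icc 1 I.T \ m.Ψ s) fun t k => r t k ω) ⁻¹'
            {ρ | I.history ρ (t - 1) s = F}) := by
    rintro ω ⟨hfail, hhist⟩
    constructor
    · refine (hDr ω).2 ?_
      have hh := hω₁.trans (Eq.symm hhist)
      have hitem := I.item_eq_of_history_eq hh
      have hidx : m.Ψ s = (I.run (fun t k => r t k ω) (t - 1)).Ψ s := by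
        rw [hm, ← image_fst_history, ← image_fst_history, hh]
      rw [Set.mem_ofPred_eq, ConfidenceFails, ← hidx, ← I.spread_congr hitem,
        ← I.estimate_congr (y := fun τ => r τ (m.item τ) ω) hitem
          (fun τ hτ => by rw [hm, hitem τ hτ])] at hfail
      have hest := I.abs_estimate_sub_le (m.Ψ s) m.item (fun τ => r τ (m.item τ) ω) t k θ hθ
      rw [hD, Set.mem_ofPred_eq]
      change (I.α + 1) * I.spread (m.Ψ s) m.item t k < _ at hfail
      have := hfail.trans_le hest
      linarith
    · rw [Set.mem_preimage, Set.mem_ofPred_eq, ← hF, I.history_restrictTo_eq_iff ht']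
      exact hhist
  have hprod := (indepFun_restrictTo hr hind hΨ (Finset.sdiff_subset (s := Finset.Icc 1 I.T)
    (t := m.Ψ s)) Finset.disjoint_sdiff).measure_inter_preimage_eq_mul _ _ hDm
      (I.measurableSet_history_eq (t - 1) s F)
  refine (measure_mono hsubset).trans (hprod.trans_le ?_)
  refine mul_le_mul' ?_ (le_of_eq ?_)
  · refine le_trans (measure_mono fun ω hω => ?_) (I.measure_noise_gt_le θ hα hind hsub hΨ m.item t k)
    exact (hDr ω).1 hω
  · congr 1
    ext ω
    rw [Set.mem_preimage, Set.mem_ofPred_eq, ← hF, I.history_restrictTo_eq_iff ht']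
    rfl

open Classical in
-- A union bound over items and levels for each round, then Markov over the rounds: the expected
-- count is at most 4 · `levels` · q, so the number of levels cancels against the threshold.
theorem measure_failing_rounds_le (hα : 0 ≤ I.α) (hθ : ‖θ‖ ≤ 1)
    (hr : ∀ t ∈ Finset.Icc 1 I.T, ∀ k, Measurable (r t k))
    (hind : iIndepFun (fun (t : Finset.Icc 1 I.T) ω k => r t k ω) P)
    (hsub : ∀ t ∈ Finset.Icc 1 I.T, ∀ k,
      HasSubgaussianMGF (fun ω => r t k ω - inner ℝ (I.μ t k) θ) (1 / 4) P) {q : ℝ}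
    (hq : I.T * K * (2 * Real.exp (-(2 * I.α ^ 2))) ≤ 4 * q) :
    P {ω | 4 * I.levels ≤ {t ∈ Finset.Icc 1 I.T | ∃ s ∈ Finset.Icc 1 I.levels, ∃ k,
        I.ConfidenceFails θ (fun t k => r t k ω) t s k}.card} ≤ ENNReal.ofReal q := by
  have hbound : ∀ t ∈ Finset.Icc 1 I.T, P {ω | ∃ s ∈ Finset.Icc 1 I.levels, ∃ k,
        I.ConfidenceFails θ (fun t k => r t k ω) t s k}
      ≤ ENNReal.ofReal (I.levels * (K * (2 * Real.exp (-(2 * I.α ^ 2))))) := by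
    intro t ht
    have e : {ω | ∃ s ∈ Finset.Icc 1 I.levels, ∃ k,
        I.ConfidenceFails θ (fun t k => r t k ω) t s k}
        = ⋃ s ∈ Finset.Icc 1 I.levels, ⋃ k ∈ (Finset.univ : Finset (Fin K)),
          {ω | I.ConfidenceFails θ (fun t k => r t k ω) t s k} := by
      ext ω; simp
    rw [e]
    refine (measure_biUnion_finset_le _ _).trans ?_
    refine (Finset.sum_le_sum fun s _ => (measure_biUnion_finset_le _ _).trans
      (Finset.sum_le_sum fun k _ => I.measure_confidenceFails_le θ hα hθ hr hind hsub
        (Finset.mem_Icc.1 ht).2 s k)).trans (le_of_eq ?_)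
    rw [Finset.sum_const, Finset.sum_const, Nat.card_Icc, Nat.add_sub_cancel, Finset.card_univ,
      Fintype.card_fin, nsmul_eq_mul, nsmul_eq_mul, ENNReal.ofReal_mul (Nat.cast_nonneg _),
      ENNReal.ofReal_mul (Nat.cast_nonneg _), ENNReal.ofReal_natCast, ENNReal.ofReal_natCast]
  refine measure_card_ge_le (Finset.Icc 1 I.T) (fun t => {ω | ∃ s ∈ Finset.Icc 1 I.levels, ∃ k,
        I.ConfidenceFails θ (fun t k => r t k ω) t s k}) (by simp [levels]) ?_
  refine (Finset.sum_le_sum hbound).trans ?_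
  rw [Finset.sum_const, Nat.card_Icc, Nat.add_sub_cancel, nsmul_eq_mul, ← ENNReal.ofReal_natCast,
    ← ENNReal.ofReal_natCast, ← ENNReal.ofReal_mul (by positivity),
    ← ENNReal.ofReal_mul (by positivity)]
  refine ENNReal.ofReal_le_ofReal ?_
  push_cast
  have h0 : (0 : ℝ) ≤ I.levels := by positivity
  nlinarith [mul_le_mul_of_nonneg_left hq h0]

end Confidence

end RENInput

/-! ### Sub-Gaussian bounds for random choices and for Gaussian contexts -/

section Tools

variable {Ω : Type*} [MeasurableSpace Ω] {P : Measure Ω}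

theorem lintegral_exp_mul_le {X : Ω → ℝ} {c : NNReal} (h : HasSubgaussianMGF X c P) (l : ℝ) :
    ∫⁻ ω, ENNReal.ofReal (Real.exp (l * X ω)) ∂P ≤ ENNReal.ofReal (Real.exp (c * l ^ 2 / 2)) := by
  rw [← ofReal_integral_eq_lintegral_ofReal (h.integrable_exp_mul l)
    (Filter.Eventually.of_forall fun ω => (Real.exp_pos _).le)]
  exact ENNReal.ofReal_le_ofReal (h.mgf_le l)

/-- A finite bound on the Lebesgue integral supplies integrability as well, so product estimates can
be made in `ENNReal` without side conditions. -/
theorem hasSubgaussianMGF_of_lintegral {X : Ω → ℝ} {c : NNReal} (hX : Measurable X)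
    (h : ∀ l : ℝ, ∫⁻ ω, ENNReal.ofReal (Real.exp (l * X ω)) ∂P
      ≤ ENNReal.ofReal (Real.exp (c * l ^ 2 / 2))) : HasSubgaussianMGF X c P where
  integrable_exp_mul l := by
    refine ⟨(by fun_prop : Measurable fun ω => Real.exp (l * X ω)).aestronglyMeasurable, ?_⟩
    rw [hasFiniteIntegral_iff_ofReal (Filter.Eventually.of_forall fun ω => (Real.exp_pos _).le)]
    exact (h l).trans_lt ENNReal.ofReal_lt_top
  mgf_le l := by
    rw [mgf, integral_eq_lintegral_of_nonneg_ae
      (Filter.Eventually.of_forall fun ω => (Real.exp_pos _).le)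
      (by fun_prop : Measurable fun ω => Real.exp (l * X ω)).aestronglyMeasurable]
    exact ENNReal.toReal_le_of_le_ofReal (Real.exp_pos _).le (h l)

theorem measurable_finite_choice {α β ι : Type*} [MeasurableSpace α] [MeasurableSpace β]
    [MeasurableSpace ι] [Countable ι] [MeasurableSingletonClass ι] {f : α → ι} {g : ι → α → β}
    (hf : Measurable f) (hg : ∀ k, Measurable (g k)) : Measurable fun x => g (f x) x := by
  have : Measurable fun p : ι × α => g p.1 p.2 := measurable_from_prod_countable_right hg
  exact this.comp (hf.prodMk measurable_id)

/-- A sub-Gaussian bound for a random choice among finitely many variables, where the choice is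
determined by the conditioning information. -/
theorem hasSubgaussianMGF_of_condSubgaussian {Ω : Type*} {m : MeasurableSpace Ω}
    [mΩ : MeasurableSpace Ω] {P : Measure Ω} [IsProbabilityMeasure P] {ι : Type*} [Fintype ι]
    [MeasurableSpace ι] [MeasurableSingletonClass ι] (hm : m ≤ mΩ) {X : ι → Ω → ℝ} {c : NNReal} (hX : ∀ i, Measurable (X i))
    (h : ∀ i, CondSubgaussian P m (X i) c) {f : Ω → ι} (hf : Measurable[m] f) :
    HasSubgaussianMGF (fun ω => X (f ω) ω) c P := by
  have hf' : Measurable f := hf.mono hm le_rfl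
  refine hasSubgaussianMGF_of_lintegral (measurable_finite_choice hf' hX) fun l => ?_
  have hG : ∀ i, MeasurableSet {ω | f ω = i} := fun i => hf' (measurableSet_singleton i)
  -- The piece on which item i is chosen belongs to `m`, so the conditional bound can be integrated
  -- over it.
  have hpiece : ∀ i, ∫⁻ ω in {ω | f ω = i}, ENNReal.ofReal (Real.exp (l * X i ω)) ∂P
      ≤ ENNReal.ofReal (Real.exp (c * l ^ 2 / 2)) * P {ω | f ω = i} := by
    intro i
    obtain ⟨hint, hle⟩ := h i l
    have hGm : MeasurableSet[m] {ω | f ω = i} := hf (measurableSet_singleton i)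
    rw [← ofReal_integral_eq_lintegral_ofReal hint.integrableOn
      (Filter.Eventually.of_forall fun ω => (Real.exp_pos _).le),
      ← setIntegral_condExp hm hint hGm, ← ofReal_measureReal,
      ← ENNReal.ofReal_mul (Real.exp_pos _).le]
    refine ENNReal.ofReal_le_ofReal ?_
    calc _ ≤ ∫ ω in {ω | f ω = i}, Real.exp (c * l ^ 2 / 2) ∂P :=
          setIntegral_mono_ae integrable_condExp.integrableOn (integrable_const _).integrableOn hle
      _ = _ := by rw [setIntegral_const, smul_eq_mul, mul_comm]
  have hU : (Set.univ : Set Ω) = ⋃ i ∈ (Finset.univ : Finset ι), {ω | f ω = i} := by ext; simp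
  have hdis : Set.PairwiseDisjoint ((Finset.univ : Finset ι) : Set ι) fun i => {ω | f ω = i} := by
    intro i _ j _ hij
    exact Set.disjoint_left.2 fun ω h1 h2 => hij (Eq.trans (Eq.symm h1) h2)
  calc ∫⁻ ω, ENNReal.ofReal (Real.exp (l * X (f ω) ω)) ∂P
      = ∑ i, ∫⁻ ω in {ω | f ω = i}, ENNReal.ofReal (Real.exp (l * X (f ω) ω)) ∂P := by
        rw [← lintegral_biUnion_finset hdis (fun i _ => hG i), ← hU, Measure.restrict_univ]
    _ = ∑ i, ∫⁻ ω in {ω | f ω = i}, ENNReal.ofReal (Real.exp (l * X i ω)) ∂P := by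
        refine Finset.sum_congr rfl fun i _ => setLIntegral_congr_fun (hG i) fun ω hω => ?_
        have hω' : f ω = i := hω
        simp only [hω']
    _ ≤ ∑ i, ENNReal.ofReal (Real.exp (c * l ^ 2 / 2)) * P {ω | f ω = i} :=
        Finset.sum_le_sum fun i _ => hpiece i
    _ = ENNReal.ofReal (Real.exp (c * l ^ 2 / 2)) := by
        rw [← Finset.mul_sum, ← measure_biUnion_finset hdis (fun i _ => hG i), ← hU,
          measure_univ, mul_one]

/-- A linear functional of a Gaussian vector with independent coordinates. -/
theorem hasSubgaussianMGF_inner_gaussian {d : ℕ} {x : Ω → EuclideanSpace ℝ (Fin d)}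
    (hx : Measurable x) {m : EuclideanSpace ℝ (Fin d)} {σ : Fin d → ℝ}
    (hlaw : P.map x = multivariateGaussian m (Matrix.diagonal fun i => σ i ^ 2))
    {θ : EuclideanSpace ℝ (Fin d)} (hθ : ‖θ‖ ≤ 1) {c : NNReal} (hc : ‖σ‖ ^ 2 ≤ c) :
    HasSubgaussianMGF (fun ω => inner ℝ (x ω) θ - inner ℝ m θ) c P := by
  set γ := multivariateGaussian m (Matrix.diagonal fun i => σ i ^ 2) with hγ
  have hpsd : (Matrix.diagonal fun i => σ i ^ 2).PosSemidef :=
    Matrix.PosSemidef.diagonal fun i => sq_nonneg (σ i)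
  have hmem : MemLp id 2 γ := IsGaussian.memLp_two_id
  -- The variance is ∑ σᵢ²θᵢ² ≤ ‖σ‖_∞² ‖θ‖².
  have hvar : Var[fun u => inner ℝ θ u; γ] ≤ c := by
    rw [← covarianceBilin_self hmem, hγ, covarianceBilin_multivariateGaussian hpsd]
    refine le_trans ?_ hc
    simp only [Matrix.mulVec_diagonal, dotProduct]
    have h1 : ∀ i, θ i * (σ i ^ 2 * θ i) ≤ ‖σ‖ ^ 2 * ‖θ i‖ ^ 2 := fun i => by
      have h2 : σ i ^ 2 ≤ ‖σ‖ ^ 2 := by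
        rw [← sq_abs (σ i), ← Real.norm_eq_abs]
        exact pow_le_pow_left₀ (norm_nonneg _) (norm_le_pi_norm σ i) 2
      rw [Real.norm_eq_abs, sq_abs]
      nlinarith [sq_nonneg (θ i)]
    refine (Finset.sum_le_sum fun i _ => h1 i).trans ?_
    rw [← Finset.mul_sum, ← EuclideanSpace.norm_sq_eq]
    exact mul_le_of_le_one_right (sq_nonneg _) (pow_le_one₀ (norm_nonneg _) hθ)
  have hmean : ∫ u, inner ℝ θ u ∂γ = inner ℝ θ m := by
    have h1 := (innerSL ℝ θ).integral_comp_comm (IsGaussian.integrable_fun_id (μ := γ))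
    rw [hγ, integral_id_multivariateGaussian] at h1
    exact h1
  have hY : P.map (fun ω => inner ℝ θ (x ω))
      = gaussianReal (inner ℝ θ m) (Var[fun u => inner ℝ θ u; γ]).toNNReal := by
    have h1 := IsGaussian.map_eq_gaussianReal (μ := γ) (innerSL ℝ θ)
    rw [← hlaw, Measure.map_map (by fun_prop) hx, hlaw] at h1
    rw [← hmean]
    exact h1
  have hmgf := fun l => mgf_gaussianReal hY l
  constructor
  · intro l
    have h1 : Integrable (fun y => Real.exp (l * y)) (P.map fun ω => inner ℝ θ (x ω)) := by
      rw [hY]; exact integrable_exp_mul_gaussianReal l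
    have h2 := (h1.comp_measurable (by fun_prop)).mul_const (Real.exp (-(l * inner ℝ m θ)))
    refine h2.congr (Filter.Eventually.of_forall fun ω => ?_)
    simp only [Function.comp_apply]
    rw [← Real.exp_add, real_inner_comm]
    congr 1; ring
  · intro l
    have e : mgf (fun ω => inner ℝ (x ω) θ - inner ℝ m θ) P l
        = mgf (fun ω => inner ℝ θ (x ω)) P l * Real.exp (-(l * inner ℝ m θ)) := by
      rw [mgf, mgf, ← integral_mul_const]
      refine integral_congr_ae (Filter.Eventually.of_forall fun ω => ?_)
      simp only
      rw [← Real.exp_add, real_inner_comm]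
      congr 1; ring
    rw [e, hmgf, ← Real.exp_add]
    refine Real.exp_le_exp.2 ?_
    rw [Real.coe_toNNReal _ (variance_nonneg _ _), real_inner_comm]
    have := mul_le_mul_of_nonneg_right hvar (sq_nonneg l)
    linarith [mul_comm l (inner ℝ m θ)]

end Tools

/-! ### Noise of the chosen items -/

namespace RENInput

variable {d K : ℕ}

/-- The rewards received by the learner, centred at their means, behave like martingale
differences. -/
theorem hasSubgaussianMGF_sum_chosen {Ω : Type*} [MeasurableSpace Ω] {P : Measure Ω}
    [IsProbabilityMeasure P] (I : RENInput d K) (θ : EuclideanSpace ℝ (Fin d))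
    {r : ℕ → Fin K → Ω → ℝ} (hr : ∀ t ∈ Finset.Icc 1 I.T, ∀ k, Measurable (r t k))
    (hind : iIndepFun (fun (t : Finset.Icc 1 I.T) ω k => r t k ω) P)
    (hsub : ∀ t ∈ Finset.Icc 1 I.T, ∀ k,
      HasSubgaussianMGF (fun ω => r t k ω - inner ℝ (I.μ t k) θ) (1 / 4) P) :
    ∀ n ≤ I.T, HasSubgaussianMGF (fun ω => ∑ t ∈ Finset.Icc 1 n,
      (inner ℝ (I.μ t (I.chosen (fun t k => r t k ω) t)) θ
        - r t (I.chosen (fun t k => r t k ω) t) ω)) (n * (1 / 4)) P := by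
  let G : ℕ → (ℕ → Fin K → ℝ) → ℝ := fun n ρ => ∑ t ∈ Finset.Icc 1 n,
    (inner ℝ (I.μ t (I.chosen ρ t)) θ - ρ t (I.chosen ρ t))
  have hG : ∀ n, Measurable (G n) := fun n => Finset.measurable_sum _ fun t _ =>
    (measurable_finite_choice (g := fun k _ => inner ℝ (I.μ t k) θ) (I.measurable_chosen t)
      fun k => measurable_const).sub
    (measurable_finite_choice (g := fun k (ρ : ℕ → Fin K → ℝ) => ρ t k) (I.measurable_chosen t)
      fun k => by fun_prop)
  have hchosen : ∀ n (ρ : ℕ → Fin K → ℝ), ∀ t ∈ Finset.Icc 1 (n + 1),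
      I.chosen (restrictTo (Finset.Icc 1 n) ρ) t = I.chosen ρ t := by
    intro n ρ t ht
    obtain ⟨h1, h2⟩ := Finset.mem_Icc.1 ht
    obtain ⟨u, rfl⟩ : ∃ u, t = u + 1 := ⟨t - 1, by omega⟩
    rw [chosen, chosen, I.run_congr u fun τ hτ => ?_]
    rw [restrictTo, if_pos]
    rw [Finset.mem_Icc] at hτ ⊢
    omega
  have hGr : ∀ n (ρ : ℕ → Fin K → ℝ), G n (restrictTo (Finset.Icc 1 n) ρ) = G n ρ := by
    intro n ρ
    refine Finset.sum_congr rfl fun t ht => ?_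
    rw [hchosen n ρ t (Finset.Icc_subset_Icc_right (Nat.le_succ n) ht), restrictTo, if_pos ht]
  have hmeasG : ∀ n ≤ I.T, Measurable fun ω => G n fun t k => r t k ω := by
    intro n hn
    simp_rw [← hGr n fun t k => r t k _]
    exact (hG n).comp (measurable_restrictTo_apply hr (Finset.Icc_subset_Icc_right hn))
  intro n
  induction n with
  | zero =>
    intro _
    simp only [Finset.Icc_eq_empty_of_lt zero_lt_one, Finset.sum_empty, Nat.cast_zero, zero_mul]
    exact HasSubgaussianMGF.fun_zero
  | succ n ih =>
    intro hn
    have ih' := ih ((Nat.le_succ n).trans hn)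
    refine hasSubgaussianMGF_of_lintegral (hmeasG (n + 1) hn) fun l => ?_
    have hB : Finset.Icc 1 n ⊆ Finset.Icc 1 I.T :=
      Finset.Icc_subset_Icc_right ((Nat.le_succ n).trans hn)
    have hmem : n + 1 ∈ Finset.Icc 1 I.T := Finset.mem_Icc.2 ⟨by omega, hn⟩
    have hC : ({n + 1} : Finset ℕ) ⊆ Finset.Icc 1 I.T := Finset.singleton_subset_iff.2 hmem
    have hindep := indepFun_restrictTo hr hind hB hC (by simp)
    let U : Fin K → (ℕ → Fin K → ℝ) → ENNReal := fun k =>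
      {ρ | I.chosen ρ (n + 1) = k}.indicator fun ρ => ENNReal.ofReal (Real.exp (l * G n ρ))
    let V : Fin K → (ℕ → Fin K → ℝ) → ENNReal := fun k ρ =>
      ENNReal.ofReal (Real.exp (-l * (ρ (n + 1) k - inner ℝ (I.μ (n + 1) k) θ)))
    have hGn := hG n
    have hU : ∀ k, Measurable (U k) := fun k =>
      (by fun_prop : Measurable fun ρ => ENNReal.ofReal (Real.exp (l * G n ρ))).indicator
        (I.measurable_chosen (n + 1) (measurableSet_singleton k))
    have hV : ∀ k, Measurable (V k) := fun k => by fun_prop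
    -- Splitting by the item chosen at round n + 1 replaces conditioning: `U k` depends on the first
    -- n rounds, `V k` on round n + 1 alone, so each product factorizes.
    have hsplit : ∀ ω, ENNReal.ofReal (Real.exp (l * G (n + 1) fun t k => r t k ω))
        = ∑ k, U k (restrictTo (Finset.Icc 1 n) fun t k => r t k ω)
            * V k (restrictTo {n + 1} fun t k => r t k ω) := by
      intro ω
      rw [Finset.sum_eq_single (I.chosen (fun t k => r t k ω) (n + 1))]
      · have e1 : I.chosen (restrictTo (Finset.Icc 1 n) fun t k => r t k ω) (n + 1)
            = I.chosen (fun t k => r t k ω) (n + 1) := hchosen n _ _ (by simp)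
        simp only [U, V]
        rw [Set.indicator_of_mem (by exact e1), hGr,
          ← ENNReal.ofReal_mul (Real.exp_pos _).le, ← Real.exp_add, restrictTo,
          if_pos (Finset.mem_singleton_self _)]
        congr 2
        simp only [G]
        rw [Finset.sum_Icc_succ_top (by omega)]
        ring
      · intro k _ hk
        simp only [U]
        rw [Set.indicator_of_notMem, zero_mul]
        intro h
        refine hk (Eq.symm ?_)
        rw [← hchosen n _ (n + 1) (by simp)]
        exact h
      · simp
    have hfac : ∀ k, ∫⁻ ω, U k (restrictTo (Finset.Icc 1 n) fun t k => r t k ω)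
          * V k (restrictTo {n + 1} fun t k => r t k ω) ∂P
        ≤ (∫⁻ ω, U k (restrictTo (Finset.Icc 1 n) fun t k => r t k ω) ∂P)
          * ENNReal.ofReal (Real.exp (1 / 4 * l ^ 2 / 2)) := by
      intro k
      have h1 := lintegral_mul_eq_lintegral_mul_lintegral_of_indepFun
        ((hU k).comp (measurable_restrictTo_apply hr hB))
        ((hV k).comp (measurable_restrictTo_apply hr hC)) (hindep.comp (hU k) (hV k))
      refine (le_of_eq h1).trans (mul_le_mul_right ?_ _)
      have h2 := lintegral_exp_mul_le (hsub (n + 1) hmem k) (-l)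
      rw [neg_sq] at h2
      refine le_trans (le_of_eq ?_) (h2.trans (le_of_eq (by norm_num)))
      refine lintegral_congr fun ω => ?_
      simp only [Function.comp_apply, V]
      rw [restrictTo, if_pos (Finset.mem_singleton_self _)]
    have hUsum : ∀ ω, ∑ k, U k (restrictTo (Finset.Icc 1 n) fun t k => r t k ω)
        = ENNReal.ofReal (Real.exp (l * G n fun t k => r t k ω)) := by
      intro ω
      rw [Finset.sum_eq_single
        (I.chosen (restrictTo (Finset.Icc 1 n) fun t k => r t k ω) (n + 1))]
      · simp only [U]
        rw [Set.indicator_of_mem (by rfl), hGr]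
      · intro k _ hk
        simp only [U]
        rw [Set.indicator_of_notMem]
        exact fun h => hk (Eq.symm h)
      · simp
    calc ∫⁻ ω, ENNReal.ofReal (Real.exp (l * G (n + 1) fun t k => r t k ω)) ∂P
        = ∑ k, ∫⁻ ω, U k (restrictTo (Finset.Icc 1 n) fun t k => r t k ω)
            * V k (restrictTo {n + 1} fun t k => r t k ω) ∂P := by
          simp_rw [hsplit]
          exact lintegral_finsetSum _ fun k _ =>
            ((hU k).comp (measurable_restrictTo_apply hr hB)).mul
              ((hV k).comp (measurable_restrictTo_apply hr hC))
      _ ≤ ∑ k, (∫⁻ ω, U k (restrictTo (Finset.Icc 1 n) fun t k => r t k ω) ∂P)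
            * ENNReal.ofReal (Real.exp (1 / 4 * l ^ 2 / 2)) :=
          Finset.sum_le_sum fun k _ => hfac k
      _ = (∫⁻ ω, ENNReal.ofReal (Real.exp (l * G n fun t k => r t k ω)) ∂P)
            * ENNReal.ofReal (Real.exp (1 / 4 * l ^ 2 / 2)) := by
          simp_rw [← Finset.sum_mul, ← hUsum]
          congr 1
          exact (lintegral_finsetSum _ fun k _ =>
            (hU k).comp (measurable_restrictTo_apply hr hB)).symm
      _ ≤ ENNReal.ofReal (Real.exp ((n * (1 / 4) : NNReal) * l ^ 2 / 2))
            * ENNReal.ofReal (Real.exp (1 / 4 * l ^ 2 / 2)) :=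
          mul_le_mul_left (lintegral_exp_mul_le ih' l) _
      _ = _ := by
          rw [← ENNReal.ofReal_mul (Real.exp_pos _).le, ← Real.exp_add]
          congr 2
          push_cast
          ring

end RENInput

/-! ### Numerical estimates -/

theorem one_le_log_four : (1.386 : ℝ) ≤ Real.log 4 := by
  have : Real.log 4 = 2 * Real.log 2 := by
    rw [show (4 : ℝ) = 2 ^ 2 by norm_num, Real.log_pow]; norm_num
  rw [this]
  linarith [Real.log_two_gt_d9]

theorem rpow_three_halves {u : ℝ} (hu : 0 ≤ u) : u ^ (3 / 2 : ℝ) = Real.sqrt u ^ 3 := by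
  rw [Real.sqrt_eq_rpow, ← Real.rpow_natCast, ← Real.rpow_mul hu]
  norm_num

/-- The logarithm that occurs in the bound of the regret. -/
noncomputable def regretLog (K T : ℕ) (δ : ℝ) : ℝ :=
  Real.log (2 * T * K * (2 * Real.log T + 2) / δ)

section Logarithms

variable {K T : ℕ} {δ : ℝ}

/-- Since 2 ln T + 2 ≥ 2, the argument of the logarithm is at least 4TK/δ; the probability estimates
draw only on this. -/
theorem four_mul_le (hK : 1 ≤ K) (hT : 1 ≤ T) (hδ : 0 < δ) :
    4 * T * K / δ ≤ 2 * T * K * (2 * Real.log T + 2) / δ := by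
  have hlog : 0 ≤ Real.log T := Real.log_natCast_nonneg T
  have hTK : (0 : ℝ) ≤ T * K := by positivity
  refine div_le_div_of_nonneg_right ?_ hδ.le
  nlinarith [mul_nonneg hTK hlog]

theorem log_le_regretLog (hK : 1 ≤ K) (hT : 1 ≤ T) (hδ : 0 < δ) {a : ℝ} (ha : 0 < a)
    (h : a ≤ 4 * T * K / δ) : Real.log a ≤ regretLog K T δ :=
  Real.log_le_log ha (h.trans (four_mul_le hK hT hδ))

theorem exp_neg_regretLog_le (hK : 1 ≤ K) (hT : 1 ≤ T) (hδ : 0 < δ) :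
    T * K * Real.exp (-regretLog K T δ) ≤ δ / 4 := by
  have hT' : (0 : ℝ) < T := by exact_mod_cast hT
  have hK' : (0 : ℝ) < K := by exact_mod_cast hK
  have hpos : 0 < 4 * T * K / δ := by positivity
  have h := four_mul_le hK hT hδ
  rw [regretLog, Real.exp_neg, Real.exp_log (hpos.trans_le h)]
  calc _ ≤ T * K * (4 * T * K / δ)⁻¹ := by gcongr
    _ = δ / 4 := by field_simp

theorem four_mul_T_le (hK : 1 ≤ K) (hδ : 0 < δ) (hδ1 : δ < 1) :
    4 * (T : ℝ) ≤ 4 * T * K / δ := by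
  have hK' : (1 : ℝ) ≤ K := by exact_mod_cast hK
  have hT' : (0 : ℝ) ≤ T := by positivity
  rw [le_div_iff₀ hδ]
  calc 4 * (T : ℝ) * δ ≤ 4 * T * 1 := by gcongr
    _ ≤ _ := by gcongr

end Logarithms

/-- Here L is `regretLog`, S the number of levels, ℓ = ln(1 + T) and ℓ' = ln(TK/δ). Every term is
compared with q³√(Td), where q = √(1 + L) ≥ 1.5; the constants 1.42, 2.84, 5.84 and 8·8 add up to
less than 92. -/
theorem regret_numeric {L α S T d ℓ ℓ' : ℝ} (hL : 1.386 ≤ L)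
    (hα : α ^ 2 ≤ L / 2) (hS0 : 0 ≤ S) (hS : 1.386 * S ≤ L) (hT : 1 ≤ T) (hd : 1 ≤ d)
    (hℓ : ℓ ≤ L) (hℓ' : ℓ' ≤ L) :
    2 * Real.sqrt (T * L / 2) + 2 * Real.sqrt (2 * L) * Real.sqrt T + 8 * S
      + 8 * (((α + 1) * Real.sqrt (2 * d * ℓ) + 2 * (4 * Real.sqrt d + 2 * Real.sqrt ℓ'))
        * Real.sqrt (S * T))
      ≤ 92 * (1 + L) ^ (3 / 2 : ℝ) * Real.sqrt (T * d) := by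
  rw [rpow_three_halves (by linarith)]
  set q := Real.sqrt (1 + L) with hq
  have hq2 : q ^ 2 = 1 + L := Real.sq_sqrt (by linarith)
  have hq1 : 1.5 ≤ q := Real.le_sqrt_of_sq_le (by norm_num; linarith)
  have hq0 : 0 ≤ q := by linarith
  set a := Real.sqrt T with ha
  set b := Real.sqrt d with hb
  have ha1 : 1 ≤ a := Real.one_le_sqrt.2 hT
  have hb1 : 1 ≤ b := Real.one_le_sqrt.2 hd
  have hTd : Real.sqrt (T * d) = a * b := Real.sqrt_mul (by linarith) d
  have ha2 : a ^ 2 = T := Real.sq_sqrt (by linarith)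
  have hb2 : b ^ 2 = d := Real.sq_sqrt (by linarith)
  have e1 : Real.sqrt (T * L / 2) ≤ 0.71 * (a * q) := by
    refine Real.sqrt_le_iff.2 ⟨by positivity, ?_⟩
    rw [mul_pow, mul_pow, ha2, hq2]
    nlinarith
  have e2 : Real.sqrt (2 * L) ≤ 1.42 * q := by
    refine Real.sqrt_le_iff.2 ⟨by positivity, ?_⟩
    rw [mul_pow, hq2]
    nlinarith
  have e3 : S ≤ 0.73 * q ^ 2 := by rw [hq2]; linarith
  have e4 : α + 1 ≤ 1.4 * q := by
    have : α ≤ 0.71 * q := by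
      refine abs_le_of_sq_le_sq' ?_ (by positivity) |>.2
      rw [mul_pow, hq2]
      linarith
    linarith
  have e5 : Real.sqrt (2 * d * ℓ) ≤ 1.42 * (b * q) := by
    refine Real.sqrt_le_iff.2 ⟨by positivity, ?_⟩
    rw [mul_pow, mul_pow, hb2, hq2]
    nlinarith
  have e6 : Real.sqrt ℓ' ≤ q := Real.sqrt_le_sqrt (by linarith)
  have e7 : Real.sqrt (S * T) ≤ 0.86 * (q * a) := by
    refine Real.sqrt_le_iff.2 ⟨by positivity, ?_⟩
    rw [mul_pow, mul_pow, ha2, hq2]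
    nlinarith
  rw [hTd]
  have hW : 1 ≤ a * b := one_le_mul_of_one_le_of_one_le ha1 hb1
  have haW : a ≤ a * b := le_mul_of_one_le_right (by linarith) hb1
  have q23 : 1.5 * q ^ 2 ≤ q ^ 3 := by
    calc 1.5 * q ^ 2 ≤ q * q ^ 2 := by gcongr
      _ = q ^ 3 := by ring
  have q13 : 2.25 * q ≤ q ^ 3 := by
    have : 1.5 * q ≤ q * q := by gcongr
    linarith [sq q]
  have f1 : 2 * Real.sqrt (T * L / 2) ≤ 1.42 * (q ^ 3 * (a * b)) := by
    have : a * q ≤ (a * b) * q ^ 3 :=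
      mul_le_mul haW (by linarith) hq0 (by positivity)
    linarith
  have f2 : 2 * Real.sqrt (2 * L) * a ≤ 2.84 * (q ^ 3 * (a * b)) := by
    have h1 : 2 * Real.sqrt (2 * L) * a ≤ 2 * (1.42 * q) * a := by gcongr
    have : a * q ≤ (a * b) * q ^ 3 :=
      mul_le_mul haW (by linarith) hq0 (by positivity)
    linarith
  have f3 : 8 * S ≤ 5.84 * (q ^ 3 * (a * b)) := by
    have : q ^ 2 * 1 ≤ q ^ 3 * (a * b) :=
      mul_le_mul (by linarith [sq_nonneg q]) hW zero_le_one (by positivity)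
    linarith
  have f4 : (α + 1) * Real.sqrt (2 * d * ℓ) + 2 * (4 * b + 2 * Real.sqrt ℓ')
      ≤ (1.4 * q) * (1.42 * (b * q)) + 2 * (4 * b + 2 * (b * q)) := by
    have : Real.sqrt ℓ' ≤ b * q := e6.trans (le_mul_of_one_le_left hq0 hb1)
    gcongr
  have f5 : ((α + 1) * Real.sqrt (2 * d * ℓ) + 2 * (4 * b + 2 * Real.sqrt ℓ')) * Real.sqrt (S * T)
      ≤ ((1.4 * q) * (1.42 * (b * q)) + 2 * (4 * b + 2 * (b * q))) * (0.86 * (q * a)) := by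
    gcongr
  have f6 : ((1.4 * q) * (1.42 * (b * q)) + 2 * (4 * b + 2 * (b * q))) * (0.86 * (q * a))
      ≤ 8 * (q ^ 3 * (a * b)) := by
    have h0 : 0 ≤ a * b := by linarith
    have g1 := mul_le_mul_of_nonneg_right q13 h0
    have g2 := mul_le_mul_of_nonneg_right q23 h0
    have g3 : 0 ≤ q ^ 3 * (a * b) := by positivity
    calc _ = 1.70968 * (q ^ 3 * (a * b)) + 6.88 * (q * (a * b)) + 3.44 * (q ^ 2 * (a * b)) := by
          ring
      _ ≤ _ := by linarith
  have f7 : 0 ≤ q ^ 3 * (a * b) := by positivity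
  linarith

/-- The logarithms differ by ln(4(1 + 1/ln T)) ≤ 9. As T ≥ 2 keeps M ≥ 0.2, additive constants are
absorbed: 1 + L ≤ 64M. This gives 92·512 plus 2·16 for the term 2√T. -/
theorem regretBound_le (d K T : ℕ) (δ : ℝ) (hd : 1 ≤ d) (hK : 1 ≤ K) (hT : 2 ≤ T) (hδ : 0 < δ)
    (hδ1 : δ < 1) :
    regretBound d K T δ ≤ 50000 * Real.sqrt (T * d * Real.log (K * T * Real.log T / δ) ^ 3) := by
  have hT' : (2 : ℝ) ≤ T := by exact_mod_cast hT
  have hK' : (1 : ℝ) ≤ K := by exact_mod_cast hK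
  have hd' : (1 : ℝ) ≤ d := by exact_mod_cast hd
  have hlogT : 0.69 ≤ Real.log T :=
    (by linarith [Real.log_two_gt_d9] : (0.69 : ℝ) ≤ Real.log 2).trans
      (Real.log_le_log (by norm_num) hT')
  have hlogT0 : 0 < Real.log T := by linarith
  set M := Real.log (K * T * Real.log T / δ) with hM
  have harg : 1.38 ≤ K * T * Real.log T / δ := by
    rw [le_div_iff₀ hδ]
    have h1 : 2 ≤ K * (T : ℝ) := by nlinarith
    have h2 : 2 * 0.69 ≤ K * T * Real.log T := mul_le_mul h1 hlogT (by norm_num) (by positivity)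
    linarith
  have hM0 : 0.2 ≤ M := by
    have h1 := Real.one_sub_inv_le_log_of_pos (show (0 : ℝ) < 1.38 by norm_num)
    have h2 := Real.log_le_log (by norm_num) harg
    norm_num at h1
    linarith
  have hLM : regretLog K T δ ≤ 9 + M := by
    have e : 2 * T * K * (2 * Real.log T + 2) / δ
        = (4 * (1 + 1 / Real.log T)) * (K * T * Real.log T / δ) := by
      field_simp
      ring
    rw [regretLog, e, Real.log_mul (by positivity) (by positivity)]
    have h1 : 4 * (1 + 1 / Real.log T) ≤ 10 := by
      have : 1 / Real.log T ≤ 1.5 := by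
        rw [div_le_iff₀ hlogT0]; linarith
      linarith
    have h2 := Real.log_le_sub_one_of_pos (show 0 < 4 * (1 + 1 / Real.log T) by positivity)
    linarith
  have hL0 : 0 ≤ regretLog K T δ := by
    have h1 := log_le_regretLog (a := 1) hK (by omega) hδ one_pos
      ((by linarith : (1 : ℝ) ≤ 4 * T).trans (four_mul_T_le hK hδ hδ1))
    rwa [Real.log_one] at h1
  have hsqM : 0.4 ≤ Real.sqrt M := Real.le_sqrt_of_sq_le (by norm_num; linarith)
  have hu : Real.sqrt (1 + regretLog K T δ) ≤ 8 * Real.sqrt M := by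
    refine Real.sqrt_le_iff.2 ⟨by positivity, ?_⟩
    rw [mul_pow, Real.sq_sqrt (by linarith)]
    linarith
  have hu3 : Real.sqrt (1 + regretLog K T δ) ^ 3 ≤ 512 * Real.sqrt M ^ 3 :=
    (pow_le_pow_left₀ (Real.sqrt_nonneg _) hu 3).trans (le_of_eq (by ring))
  have h1 : 1 ≤ 16 * Real.sqrt M ^ 3 := by
    have := pow_le_pow_left₀ (by norm_num) hsqM 3
    norm_num at this
    linarith
  have e : Real.sqrt (T * d * M ^ 3) = Real.sqrt (T * d) * Real.sqrt M ^ 3 := by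
    rw [Real.sqrt_mul (by positivity)]
    congr 1
    rw [Real.sqrt_eq_iff_eq_sq (by positivity) (by positivity), ← pow_mul, mul_comm, pow_mul,
      Real.sq_sqrt (by linarith)]
  have hTd : Real.sqrt T ≤ Real.sqrt (T * d) :=
    Real.sqrt_le_sqrt (le_mul_of_one_le_right (by linarith) hd')
  have hs : 0 ≤ Real.sqrt (T * d) := Real.sqrt_nonneg _
  rw [regretBound, ← regretLog, rpow_three_halves (by linarith), e]
  have g1 := mul_le_mul_of_nonneg_left hu3 hs
  have g2 := mul_le_mul_of_nonneg_left h1 hs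
  linarith

namespace RENInput

variable {d K : ℕ}

theorem levels_mul_le (I : RENInput d K) (hT : 1 ≤ I.T) :
    1.386 * (I.levels : ℝ) ≤ Real.log (4 * I.T) := by
  have hT' : (0 : ℝ) < I.T := by exact_mod_cast hT
  have h1 : (4 : ℝ) ^ Nat.log 4 I.T ≤ I.T := by
    exact_mod_cast Nat.pow_log_le_self 4 (by omega : I.T ≠ 0)
  have h2 := Real.log_le_log (by positivity) h1
  rw [Real.log_pow] at h2
  rw [Real.log_mul (by norm_num) hT'.ne', levels]
  push_cast
  have h3 : (0 : ℝ) ≤ Nat.log 4 I.T := by positivity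
  nlinarith [one_le_log_four]

/-! ### The exceptional events and the final bound -/

section Regret

variable {Ω : Type*} [MeasurableSpace Ω] {P : Measure Ω} [IsProbabilityMeasure P]
  {I : RENInput d K} {θ : EuclideanSpace ℝ (Fin d)} {x : ℕ → Fin K → Ω → EuclideanSpace ℝ (Fin d)}
  {r : ℕ → Fin K → Ω → ℝ}

/-- The best item depends on the contexts of its own round, so the conditional sub-Gaussian bound is
the one that survives the choice. Each summand is a function of one round, hence the summands are
independent. -/
theorem hasSubgaussianMGF_sum_best (hB : IsUncertainLinearBandit P I θ x r)
    {best : ℕ → (Fin K → EuclideanSpace ℝ (Fin d)) → Fin K} (hbest : ∀ t, Measurable (best t)) :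
    HasSubgaussianMGF (fun ω => ∑ t ∈ Finset.Icc 1 I.T,
      (r t (best t fun k => x t k ω) ω - inner ℝ (x t (best t fun k => x t k ω) ω) θ))
      (I.T * (1 / 4)) P := by
  let g : Finset.Icc 1 I.T → (Fin K → EuclideanSpace ℝ (Fin d)) × (Fin K → ℝ) → ℝ :=
    fun t p => p.2 (best t p.1) - inner ℝ (p.1 (best t p.1)) θ
  have hg : ∀ t, Measurable (g t) := fun t =>
    measurable_finite_choice (f := fun p : (Fin K → EuclideanSpace ℝ (Fin d)) × (Fin K → ℝ) =>
      best t p.1) (g := fun k p => p.2 k - inner ℝ (p.1 k) θ) ((hbest t).comp measurable_fst)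
      fun k => by fun_prop
  have hind := hB.indep_rounds.comp g hg
  have hsub : ∀ t ∈ (Finset.univ : Finset (Finset.Icc 1 I.T)), HasSubgaussianMGF
      (g t ∘ fun ω => (fun k => x t k ω, fun k => r t k ω)) (1 / 4) P := by
    intro t _
    have hx := hB.measurable_context t t.2
    have hr := hB.measurable_reward t t.2
    refine hasSubgaussianMGF_of_condSubgaussian (P := P)
      (X := fun k ω => r t k ω - inner ℝ (x t k ω) θ)
      (m := MeasurableSpace.comap (fun ω k' => x t k' ω) inferInstance)
      (measurable_pi_lambda _ hx).comap_le (fun k => ?_) (fun k => ?_)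
      ((hbest t).comp (comap_measurable _))
    · have := hx k
      have := hr k
      fun_prop
    · have := hB.reward_cond_subgaussian t t.2 k
      push_cast
      exact this
  have h := HasSubgaussianMGF.sum_of_iIndepFun hind hsub
  have e : ∑ _t : Finset.Icc 1 I.T, (1 / 4 : NNReal) = I.T * (1 / 4) := by simp
  rw [e] at h
  refine h.congr (Filter.Eventually.of_forall fun ω => ?_)
  exact Finset.sum_coe_sort (Finset.Icc 1 I.T) fun t =>
    r t (best t fun k => x t k ω) ω - inner ℝ (x t (best t fun k => x t k ω) ω) θ

/-- With proxy T/4 the exponent is (TL/2)/(T/2) = L. -/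
theorem measure_sum_ge_le {X : Ω → ℝ} (hX : HasSubgaussianMGF X (I.T * (1 / 4)) P) (hT : 1 ≤ I.T)
    (hK : 1 ≤ K) (hδ : 0 < I.δ) (hL : 0 ≤ regretLog K I.T I.δ) :
    P {ω | Real.sqrt (I.T * regretLog K I.T I.δ / 2) ≤ X ω} ≤ ENNReal.ofReal (I.δ / 4) := by
  have hT' : (1 : ℝ) ≤ I.T := by exact_mod_cast hT
  have hK' : (1 : ℝ) ≤ K := by exact_mod_cast hK
  rw [← ofReal_measureReal]
  refine ENNReal.ofReal_le_ofReal ((hX.measure_ge_le (Real.sqrt_nonneg _)).trans ?_)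
  rw [Real.sq_sqrt (by positivity)]
  push_cast
  have e : -(I.T * regretLog K I.T I.δ / 2) / (2 * (I.T * (1 / 4)))
      = -regretLog K I.T I.δ := by field_simp; norm_num
  rw [e]
  refine le_trans ?_ (exp_neg_regretLog_le hK hT hδ)
  exact le_mul_of_one_le_left (Real.exp_pos _).le (by nlinarith)

/-- The projection on θ has proxy 1/t, so the exponent at √(2L/t) is L; a union bound over the TK
pairs costs δ/4. -/
theorem measure_context_ge_le (hB : IsUncertainLinearBandit P I θ x r) (hT : 1 ≤ I.T)
    (hK : 1 ≤ K) (hδ : 0 < I.δ) (hL : 0 ≤ regretLog K I.T I.δ) :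
    P {ω | ∃ t ∈ Finset.Icc 1 I.T, ∃ k, Real.sqrt (2 * regretLog K I.T I.δ) * (1 / Real.sqrt t)
      ≤ inner ℝ (x t k ω) θ - inner ℝ (I.μ t k) θ} ≤ ENNReal.ofReal (I.δ / 4) := by
  have hpiece : ∀ t ∈ Finset.Icc 1 I.T, ∀ k,
      P {ω | Real.sqrt (2 * regretLog K I.T I.δ) * (1 / Real.sqrt t)
        ≤ inner ℝ (x t k ω) θ - inner ℝ (I.μ t k) θ}
      ≤ ENNReal.ofReal (Real.exp (-regretLog K I.T I.δ)) := by
    intro t ht k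
    have ht' : (0 : ℝ) < t := by exact_mod_cast (Finset.mem_Icc.1 ht).1
    have hsub := hasSubgaussianMGF_inner_gaussian (c := Real.toNNReal (1 / t))
      (hB.measurable_context t ht k) (hB.law_context t ht k) hB.norm_param_le (by
        rw [Real.coe_toNNReal _ (by positivity)]
        refine (pow_le_pow_left₀ (norm_nonneg _) (hB.norm_sd_le t ht k) 2).trans (le_of_eq ?_)
        rw [div_pow, one_pow, Real.sq_sqrt ht'.le])
    rw [← ofReal_measureReal]
    refine ENNReal.ofReal_le_ofReal ((hsub.measure_ge_le (by positivity)).trans (le_of_eq ?_))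
    rw [Real.coe_toNNReal _ (by positivity), mul_pow, Real.sq_sqrt (by positivity), div_pow,
      one_pow, Real.sq_sqrt ht'.le]
    congr 1
    field_simp
  have e : {ω | ∃ t ∈ Finset.Icc 1 I.T, ∃ k, Real.sqrt (2 * regretLog K I.T I.δ) * (1 / Real.sqrt t)
      ≤ inner ℝ (x t k ω) θ - inner ℝ (I.μ t k) θ}
      = ⋃ t ∈ Finset.Icc 1 I.T, ⋃ k ∈ (Finset.univ : Finset (Fin K)),
        {ω | Real.sqrt (2 * regretLog K I.T I.δ) * (1 / Real.sqrt t)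
          ≤ inner ℝ (x t k ω) θ - inner ℝ (I.μ t k) θ} := by
    ext ω; simp
  rw [e]
  refine (measure_biUnion_finset_le _ _).trans ((Finset.sum_le_sum fun t ht =>
    (measure_biUnion_finset_le _ _).trans
      (Finset.sum_le_sum fun k _ => hpiece t ht k)).trans ?_)
  rw [Finset.sum_const, Finset.sum_const, Nat.card_Icc, Nat.add_sub_cancel, Finset.card_univ,
    Fintype.card_fin, nsmul_eq_mul, nsmul_eq_mul, ← ENNReal.ofReal_natCast,
    ← ENNReal.ofReal_natCast, ← ENNReal.ofReal_mul (Nat.cast_nonneg _),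
    ← ENNReal.ofReal_mul (Nat.cast_nonneg _), ← mul_assoc]
  exact ENNReal.ofReal_le_ofReal (exp_neg_regretLog_le hK hT hδ)

open Classical in
/-- The regret outside of the exceptional events. -/
theorem regret_le_regretBound (hd : 1 ≤ d) (hK : 1 ≤ K) (hT : 1 ≤ I.T) (hδ : 0 < I.δ)
    (hδ1 : I.δ < 1) (hα : I.α = Real.sqrt (1 / 2 * Real.log (2 * I.T * K / I.δ)))
    (hpick : ∀ t s A, A.Nonempty → I.pick t s A ∈ A) (hθ : ‖θ‖ ≤ 1)
    (hμ : ∀ t ∈ Finset.Icc 1 I.T, ∀ k, ‖I.μ t k‖ ≤ 1)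
    (hσ : ∀ t ∈ Finset.Icc 1 I.T, ∀ k, ‖I.σ t k‖ ≤ 1 / Real.sqrt t)
    (ρ : ℕ → Fin K → ℝ) (X : ℕ → Fin K → EuclideanSpace ℝ (Fin d)) (best : ℕ → Fin K)
    (h1 : {t ∈ Finset.Icc 1 I.T | ∃ s ∈ Finset.Icc 1 I.levels, ∃ k,
      I.ConfidenceFails θ ρ t s k}.card < 4 * I.levels)
    (h2 : ∑ t ∈ Finset.Icc 1 I.T, (inner ℝ (I.μ t (I.chosen ρ t)) θ - ρ t (I.chosen ρ t))
      < Real.sqrt (I.T * regretLog K I.T I.δ / 2))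
    (h3 : ∑ t ∈ Finset.Icc 1 I.T, (ρ t (best t) - inner ℝ (X t (best t)) θ)
      < Real.sqrt (I.T * regretLog K I.T I.δ / 2))
    (h4 : ∀ t ∈ Finset.Icc 1 I.T, ∀ k, inner ℝ (X t k) θ - inner ℝ (I.μ t k) θ
      < Real.sqrt (2 * regretLog K I.T I.δ) * (1 / Real.sqrt t)) :
    I.regret ρ best ≤ regretBound d K I.T I.δ := by
  have hT' : (1 : ℝ) ≤ I.T := by exact_mod_cast hT
  have hK' : (1 : ℝ) ≤ K := by exact_mod_cast hK
  have hd' : (1 : ℝ) ≤ d := by exact_mod_cast hd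
  have h4T := four_mul_T_le (T := I.T) hK hδ hδ1
  have hα0 : 0 ≤ I.α := hα ▸ Real.sqrt_nonneg _
  have hlog4T := log_le_regretLog (a := 4 * I.T) hK hT hδ (by linarith) h4T
  have hL : 1.386 ≤ regretLog K I.T I.δ :=
    (one_le_log_four.trans (Real.log_le_log (by norm_num) (by linarith))).trans hlog4T
  have : Nonempty (Fin K) := ⟨⟨0, hK⟩⟩
  have hmax : ∀ t, ∃ k₀, ∀ k, inner ℝ (I.μ t k) θ ≤ (inner ℝ (I.μ t k₀) θ : ℝ) := fun t =>
    Finite.exists_max fun k => (inner ℝ (I.μ t k) θ : ℝ)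
  choose k₀ hk₀ using hmax
  have hgap := I.sum_gap_le ρ hpick hT hα0 θ hθ hμ hσ k₀ hk₀
  have hcard : ({t ∈ Finset.Icc 1 I.T | ∃ s ∈ Finset.Icc 1 I.levels, ∃ k,
      I.ConfidenceFails θ ρ t s k}.card : ℝ) ≤ 4 * I.levels := by exact_mod_cast h1.le
  have hcontext : ∑ t ∈ Finset.Icc 1 I.T,
      (inner ℝ (X t (best t)) θ - inner ℝ (I.μ t (k₀ t)) θ)
      ≤ 2 * Real.sqrt (2 * regretLog K I.T I.δ) * Real.sqrt I.T := by
    -- The true value of the best item exceeds its own mean by less than the deviation, and that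
    -- mean is at most the mean of `k₀ t`.
    have hle : ∀ t ∈ Finset.Icc 1 I.T, inner ℝ (X t (best t)) θ - inner ℝ (I.μ t (k₀ t)) θ
        ≤ Real.sqrt (2 * regretLog K I.T I.δ) * (1 / Real.sqrt t) := fun t ht => by
      have := h4 t ht (best t)
      have := hk₀ t (best t)
      linarith
    refine (Finset.sum_le_sum hle).trans ?_
    rw [← Finset.mul_sum]
    have := sum_one_div_sqrt_le (Finset.Icc 1 I.T) fun t ht => (Finset.mem_Icc.1 ht).1
    rw [Nat.card_Icc, Nat.add_sub_cancel] at this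
    have := mul_le_mul_of_nonneg_left this (Real.sqrt_nonneg (2 * regretLog K I.T I.δ))
    linarith
  have hreg : I.regret ρ best
      = ∑ t ∈ Finset.Icc 1 I.T, (ρ t (best t) - inner ℝ (X t (best t)) θ)
        + ∑ t ∈ Finset.Icc 1 I.T, (inner ℝ (X t (best t)) θ - inner ℝ (I.μ t (k₀ t)) θ)
        + ∑ t ∈ Finset.Icc 1 I.T,
            (inner ℝ (I.μ t (k₀ t)) θ - inner ℝ (I.μ t (I.chosen ρ t)) θ)
        + ∑ t ∈ Finset.Icc 1 I.T,
            (inner ℝ (I.μ t (I.chosen ρ t)) θ - ρ t (I.chosen ρ t)) := by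
    simp only [regret, Finset.sum_sub_distrib]
    ring
  have hTK : (1 : ℝ) ≤ I.T * K := by nlinarith
  have hnum := regret_numeric (L := regretLog K I.T I.δ) (α := I.α) (S := I.levels) (T := I.T)
    (d := d) (ℓ := Real.log (1 + I.T)) (ℓ' := Real.log (I.T * K / I.δ)) hL
    (by
      have h0 : 0 ≤ Real.log (2 * I.T * K / I.δ) := Real.log_nonneg (by
        rw [le_div_iff₀ hδ]; linarith)
      rw [hα, Real.sq_sqrt (by linarith)]
      have := log_le_regretLog (a := 2 * I.T * K / I.δ) hK hT hδ (by positivity)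
        (by gcongr; norm_num)
      linarith)
    (by positivity) ((I.levels_mul_le hT).trans hlog4T) hT' hd'
    (log_le_regretLog hK hT hδ (by linarith) (by linarith))
    (log_le_regretLog hK hT hδ (by positivity) (by gcongr; linarith))
  rw [hreg, regretBound, ← regretLog]
  linarith

theorem one_sub_le_measure_regret_le (hd : 1 ≤ d) (hK : 1 ≤ K) (hT : 1 ≤ I.T) (hδ : 0 < I.δ)
    (hδ1 : I.δ < 1) (hα : I.α = Real.sqrt (1 / 2 * Real.log (2 * I.T * K / I.δ)))
    (hpick : ∀ t s A, A.Nonempty → I.pick t s A ∈ A) (hB : IsUncertainLinearBandit P I θ x r)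
    {best : ℕ → (Fin K → EuclideanSpace ℝ (Fin d)) → Fin K} (hbest : ∀ t, Measurable (best t)) :
    1 - I.δ ≤ P.real {ω | I.regret (fun t k => r t k ω) (fun t => best t fun k => x t k ω)
      ≤ regretBound d K I.T I.δ} := by
  classical
  have hT' : (1 : ℝ) ≤ I.T := by exact_mod_cast hT
  have hK' : (1 : ℝ) ≤ K := by exact_mod_cast hK
  have hTK : (1 : ℝ) ≤ I.T * K := by nlinarith
  have hL : 0 ≤ regretLog K I.T I.δ := by
    have h1 := log_le_regretLog (a := 1) hK hT hδ one_pos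
      ((by linarith : (1 : ℝ) ≤ 4 * I.T).trans (four_mul_T_le hK hδ hδ1))
    rwa [Real.log_one] at h1
  have hα0 : 0 ≤ I.α := hα ▸ Real.sqrt_nonneg _
  have hind : iIndepFun (fun (t : Finset.Icc 1 I.T) ω k => r t k ω) P :=
    hB.indep_rounds.comp (fun _ => Prod.snd) fun _ => measurable_snd
  have hq : I.T * K * (2 * Real.exp (-(2 * I.α ^ 2))) ≤ 4 * (I.δ / 4) := by
    have h0 : 0 ≤ Real.log (2 * I.T * K / I.δ) := Real.log_nonneg (by
      rw [le_div_iff₀ hδ]; linarith)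
    rw [hα, Real.sq_sqrt (by linarith), ← mul_assoc 2 (1 / 2 : ℝ),
      mul_one_div_cancel two_ne_zero, one_mul, Real.exp_neg, Real.exp_log (by positivity)]
    refine le_of_eq ?_
    field_simp
  have b1 := I.measure_failing_rounds_le θ hα0 hB.norm_param_le hB.measurable_reward hind
    hB.reward_subgaussian hq
  have b2 := measure_sum_ge_le (I := I) (I.hasSubgaussianMGF_sum_chosen θ hB.measurable_reward hind
    hB.reward_subgaussian I.T le_rfl) hT hK hδ hL
  have b3 := measure_sum_ge_le (I := I) (hasSubgaussianMGF_sum_best hB hbest) hT hK hδ hL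
  have b4 := measure_context_ge_le hB hT hK hδ hL
  set G := {ω | I.regret (fun t k => r t k ω) (fun t => best t fun k => x t k ω)
      ≤ regretBound d K I.T I.δ}
  set B1 := {ω | 4 * I.levels ≤ {t ∈ Finset.Icc 1 I.T | ∃ s ∈ Finset.Icc 1 I.levels, ∃ k,
        I.ConfidenceFails θ (fun t k => r t k ω) t s k}.card}
  set B2 := {ω | Real.sqrt (I.T * regretLog K I.T I.δ / 2) ≤ ∑ t ∈ Finset.Icc 1 I.T,
      (inner ℝ (I.μ t (I.chosen (fun t k => r t k ω) t)) θ
        - r t (I.chosen (fun t k => r t k ω) t) ω)}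
  set B3 := {ω | Real.sqrt (I.T * regretLog K I.T I.δ / 2) ≤ ∑ t ∈ Finset.Icc 1 I.T,
      (r t (best t fun k => x t k ω) ω - inner ℝ (x t (best t fun k => x t k ω) ω) θ)}
  set B4 := {ω | ∃ t ∈ Finset.Icc 1 I.T, ∃ k, Real.sqrt (2 * regretLog K I.T I.δ)
    * (1 / Real.sqrt t) ≤ inner ℝ (x t k ω) θ - inner ℝ (I.μ t k) θ}
  -- Subadditivity over this cover bounds the probability of `G` from below without measurability of
  -- any of the events.
  have hcover : (Set.univ : Set Ω) ⊆ G ∪ (B1 ∪ (B2 ∪ (B3 ∪ B4))) := by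
    intro ω _
    by_contra h
    simp only [Set.mem_union, not_or] at h
    obtain ⟨g, g1, g2, g3, g4⟩ := h
    refine g (regret_le_regretBound hd hK hT hδ hδ1 hα hpick hB.norm_param_le hB.norm_mean_le
      hB.norm_sd_le (fun t k => r t k ω) (fun t k => x t k ω) _ (not_le.1 g1) (not_le.1 g2)
      (not_le.1 g3) fun t ht k => ?_)
    by_contra! hlt
    exact g4 ⟨t, ht, k, hlt⟩
  have hreal : ∀ {B : Set Ω}, P B ≤ ENNReal.ofReal (I.δ / 4) → P.real B ≤ I.δ / 4 := fun hB =>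
    ENNReal.toReal_le_of_le_ofReal (by positivity) hB
  have htotal : 1 ≤ P.real G + (P.real B1 + (P.real B2 + (P.real B3 + P.real B4))) := by
    calc 1 = P.real Set.univ := by simp
      _ ≤ P.real (G ∪ (B1 ∪ (B2 ∪ (B3 ∪ B4)))) := measureReal_mono hcover
      _ ≤ _ := by
        refine (measureReal_union_le _ _).trans (add_le_add le_rfl ?_)
        refine (measureReal_union_le _ _).trans (add_le_add le_rfl ?_)
        refine (measureReal_union_le _ _).trans (add_le_add le_rfl ?_)
        exact measureReal_union_le _ _
  linarith [hreal b1, hreal b2, hreal b3, hreal b4]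

end Regret

end RENInput

theorem theorem1 :
    (∀ {Ω : Type*} [MeasurableSpace Ω] (P : Measure Ω) [IsProbabilityMeasure P]
      (d K : ℕ) (I : RENInput d K) (θ : EuclideanSpace ℝ (Fin d))
      (x : ℕ → Fin K → Ω → EuclideanSpace ℝ (Fin d)) (r : ℕ → Fin K → Ω → ℝ)
      -- `best t X` is an item with the largest mean reward when the true contexts are `X`
      (best : ℕ → (Fin K → EuclideanSpace ℝ (Fin d)) → Fin K),
      1 ≤ d → 1 ≤ K → 1 ≤ I.T → 0 < I.δ → I.δ < 1 →
      I.α = Real.sqrt (1 / 2 * Real.log (2 * I.T * K / I.δ)) →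
      (∀ t s A, A.Nonempty → I.pick t s A ∈ A) →
      IsUncertainLinearBandit P I θ x r →
      (∀ t, Measurable (best t)) →
      (∀ t (X : Fin K → EuclideanSpace ℝ (Fin d)) k, inner ℝ (X k) θ ≤ inner ℝ (X (best t X)) θ) →
      1 - I.δ ≤ P.real {ω | I.regret (fun t k => r t k ω) (fun t => best t fun k => x t k ω)
        ≤ regretBound d K I.T I.δ}) ∧
    (∃ C : ℝ, 0 < C ∧ ∀ (d K T : ℕ) (δ : ℝ), 1 ≤ d → 1 ≤ K → 2 ≤ T → 0 < δ → δ < 1 →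
      regretBound d K T δ ≤ C * Real.sqrt (T * d * Real.log (K * T * Real.log T / δ) ^ 3)) := by
  refine ⟨?_, 50000, by norm_num, regretBound_le⟩
  intro Ω _ P _ d K I θ x r best hd hK hT hδ hδ1 hα hpick hB hbest _
  exact RENInput.one_sub_le_measure_regret_le hd hK hT hδ hδ1 hα hpick hB hbest
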